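/- Let $n\ge 2$ and let $\mathbb{S}^n\subset\mathbb{R}^{n+1}$ be the unit sphere. For $v\neq 0$ the equator orthogonal to $v$ is $\Sigma_v=\{x\in\mathbb{S}^n : \langle x,v\rangle=0\}$. Let $\mathcal{E}(\mathbb{S}^n)$ be the set of smooth Riemannian metrics on $\mathbb{S}^n$ with respect to which every equator $\Sigma_v$ is a minimal hypersurface (has zero mean curvature). For $T\in GL(n+1,\mathbb{R})$ let $\phi(T):\mathbb{S}^n\to\mathbb{S}^n$, $\phi(T)(x)=Tx/|Tx|$. Let $\pi:\mathbb{S}^n\to\mathbb{RP}^n$ be the quotient by the antipodal map; the linear projective $(n-1)$-planes of $\mathbb{RP}^n$ are the images $\pi(\Sigma_v)$. Then: 1. The antipodal map $x\mapsto -x$ is an isometry of $(\mathbb{S}^n,g)$ for every $g\in\mathcal{E}(\mathbb{S}^n)$. 2. The rule $g\cdot[T]=\phi(T)^*g$ gives a well-defined right action of $PGL(n+1,\mathbb{R})=GL(n+1,\mathbb{R})/\{\lambda\,\mathrm{Id} : \lambda\neq 0\}$ on $\mathcal{E}(\mathbb{S}^n)$; that is, there is exactly one right action of $PGL(n+1,\mathbb{R})$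 on $\mathcal{E}(\mathbb{S}^n)$ such that $g\cdot[T]=\phi(T)^*g$ for all $T\in GL(n+1,\mathbb{R})$ and $g\in\mathcal{E}(\mathbb{S}^n)$. 3. Every $g\in\mathcal{E}(\mathbb{S}^n)$ descends to $\mathbb{RP}^n$: there is exactly one smooth Riemannian metric $h$ on $\mathbb{RP}^n$ with $\pi^*h=g$. Moreover, $h\mapsto\pi^*h$ is a bijection from the set of smooth Riemannian metrics on $\mathbb{RP}^n$ with respect to which all linear projective $(n-1)$-planes are minimal onto $\mathcal{E}(\mathbb{S}^n)$. -/

import Mathlib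

open Set MulOpposite
open scoped Manifold ContDiff Bundle MatrixGroups RealInnerProductSpace

noncomputable section

/-! ### Riemannian metrics, pull-backs, isometries -/

section Riemannian

variable {n : ℕ}
  {M : Type*} [TopologicalSpace M] [ChartedSpace (EuclideanSpace ℝ (Fin n)) M]
  [IsManifold (𝓡 n) ∞ M]
  {N : Type*} [TopologicalSpace N] [ChartedSpace (EuclideanSpace ℝ (Fin n)) N]
  [IsManifold (𝓡 n) ∞ N]

/-- Smooth Riemannian metrics on the smooth `n`-manifold `M`. -/
abbrev RiemMetric (n : ℕ) (M : Type*) [TopologicalSpace M]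
    [ChartedSpace (EuclideanSpace ℝ (Fin n)) M] [IsManifold (𝓡 n) ∞ M] :=
  Bundle.ContMDiffRiemannianMetric (𝓡 n) ∞ (EuclideanSpace ℝ (Fin n))
    (fun x : M => TangentSpace (𝓡 n) x)

/-- `g' = φ^* g`, the pull-back of the metric `g` on `N` by the smooth map `φ : M → N`. -/
def IsPullback (φ : M → N) (g : RiemMetric n N) (g' : RiemMetric n M) : Prop :=
  ContMDiff (𝓡 n) (𝓡 n) ∞ φ ∧
    ∀ (x : M) (u v : TangentSpace (𝓡 n) x),
      g'.inner x u v =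
        g.inner (φ x) (mfderiv (𝓡 n) (𝓡 n) φ x u) (mfderiv (𝓡 n) (𝓡 n) φ x v)

/-- `φ : M → M` is an isometry of the Riemannian manifold `(M, g)`: a diffeomorphism with
`φ^* g = g`. -/
def IsRiemannianIsometry (φ : M → M) (g : RiemMetric n M) : Prop :=
  (∃ Φ : M ≃ₘ^∞⟮𝓡 n, 𝓡 n⟯ M, ⇑Φ = φ) ∧ IsPullback φ g g

/-! ### Mean curvature in a coordinate chart -/

/-- The metric `g` read in the preferred chart at `p`: the matrix field `y ↦ (g_{ij}(y))`, as a
field of bilinear forms on `ℝⁿ`. -/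
def metricInChart (g : RiemMetric n M) (p : M) (y : EuclideanSpace ℝ (Fin n)) :
    EuclideanSpace ℝ (Fin n) →L[ℝ] EuclideanSpace ℝ (Fin n) →L[ℝ] ℝ :=
  let L : EuclideanSpace ℝ (Fin n) →L[ℝ] EuclideanSpace ℝ (Fin n) :=
    mfderiv 𝓘(ℝ, EuclideanSpace ℝ (Fin n)) (𝓡 n) (extChartAt (𝓡 n) p).symm y
  let B : EuclideanSpace ℝ (Fin n) →L[ℝ] EuclideanSpace ℝ (Fin n) →L[ℝ] ℝ :=
    g.inner ((extChartAt (𝓡 n) p).symm y)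
  B.bilinearComp L L

variable (G : EuclideanSpace ℝ (Fin n) →
    EuclideanSpace ℝ (Fin n) →L[ℝ] EuclideanSpace ℝ (Fin n) →L[ℝ] ℝ)
  (F : EuclideanSpace ℝ (Fin n) → ℝ) (y : EuclideanSpace ℝ (Fin n))

/-- Christoffel symbols of the first kind of a field `G` of inner products on `ℝⁿ`:
`Γ(u, v; w) = (D_u G (v, w) + D_v G (u, w) - D_w G (u, v)) / 2`, as a linear form in `w`. -/
def christoffelFirst (u v : EuclideanSpace ℝ (Fin n)) : EuclideanSpace ℝ (Fin n) →L[ℝ] ℝ :=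
  (1 / 2 : ℝ) • (fderiv ℝ G y u v + fderiv ℝ G y v u - ((fderiv ℝ G y).flip u).flip v)

/-- Christoffel symbols of the second kind: `Γ(u, v)` is the value at `y` of the Levi-Civita
derivative `∇_u v` of the constant vector field `v`. (`(G y).inverse` raises an index: it is the
inverse of the isomorphism `u ↦ G y (u, ·)`.) -/
def christoffelSecond (u v : EuclideanSpace ℝ (Fin n)) : EuclideanSpace ℝ (Fin n) :=
  (G y).inverse (christoffelFirst G y u v)

/-- The gradient of `F` with respect to `G`: `G y (gradient, w) = DF(y) w`. -/
def chartGradient : EuclideanSpace ℝ (Fin n) :=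
  (G y).inverse (fderiv ℝ F y)

/-- The Hessian of `F` with respect to `G`: `Hess F (u, v) = u (v F) - (∇_u v) F`. -/
def chartHessian (u v : EuclideanSpace ℝ (Fin n)) : ℝ :=
  fderiv ℝ (fderiv ℝ F) y u v - fderiv ℝ F y (christoffelSecond G y u v)

/-- The second fundamental form `G (∇_u N, v)`, for tangent vectors `u`, `v`, of a regular level
set of `F` with respect to the unit normal `N = ∇F / |∇F|`; it equals `Hess F (u, v) / |∇F|`. -/
def chartSecondFundamentalForm (u v : EuclideanSpace ℝ (Fin n)) : ℝ :=
  chartHessian G F y u v / Real.sqrt (G y (chartGradient G F y) (chartGradient G F y))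

/-- The mean curvature at `y` of the level set of `F` through `y`, that is, the trace of the second
fundamental form over the tangent hyperplane `ker DF(y)`, is zero. The trace is computed in
orthonormal bases of the hyperplane (its value does not depend on the basis). -/
def ChartMeanCurvatureVanishes : Prop :=
  ∀ e : Fin (n - 1) → EuclideanSpace ℝ (Fin n),
    (∀ i, fderiv ℝ F y (e i) = 0) →
    (∀ i j, G y (e i) (e j) = if i = j then 1 else 0) →
    ∑ i, chartSecondFundamentalForm G F y (e i) (e i) = 0

/-! ### Minimal hypersurfaces -/

/-- `f` is a smooth regular equation of the set `S` on the open neighbourhood `U` of `p`. -/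
structure IsLocalEquation (S : Set M) (p : M) (U : Set M) (f : M → ℝ) : Prop where
  isOpen : IsOpen U
  mem : p ∈ U
  smooth : ContMDiffOn (𝓡 n) 𝓘(ℝ, ℝ) ∞ f U
  zero_iff : ∀ q ∈ U, q ∈ S ↔ f q = 0
  regular : ∀ q ∈ U, q ∈ S → mfderiv (𝓡 n) 𝓘(ℝ, ℝ) f q ≠ 0

/-- `S` is a minimal hypersurface of `(M, g)`: an embedded smooth hypersurface (it has a smooth
regular equation near each of its points) whose mean curvature is zero at each of its points. -/
def IsMinimalHypersurface (g : RiemMetric n M) (S : Set M) : Prop :=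
  ∀ p ∈ S,
    (∃ U f, IsLocalEquation (n := n) S p U f) ∧
    ∀ U f, IsLocalEquation (n := n) S p U f →
      ChartMeanCurvatureVanishes (metricInChart g p) (f ∘ (extChartAt (𝓡 n) p).symm)
        (extChartAt (𝓡 n) p p)

end Riemannian

/-! ### The sphere, its equators and the maps `φ(T)` -/

/-- The unit sphere `𝕊ⁿ` of `ℝⁿ⁺¹`. -/
abbrev Sph (n : ℕ) : Type := Metric.sphere (0 : EuclideanSpace ℝ (Fin (n + 1))) 1

/-- The equator orthogonal to `v`. -/
def equator {n : ℕ} (v : EuclideanSpace ℝ (Fin (n + 1))) : Set (Sph n) :=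
  {x | ⟪(x : EuclideanSpace ℝ (Fin (n + 1))), v⟫ = 0}

/-- The set of Riemannian metrics on `𝕊ⁿ` with respect to which all equators are minimal. -/
def MinEqMetric (n : ℕ) : Type :=
  {g : RiemMetric n (Sph n) //
    ∀ v : EuclideanSpace ℝ (Fin (n + 1)), v ≠ 0 → IsMinimalHypersurface g (equator v)}

/-- The diffeomorphism `φ(T) : x ↦ T x / |T x|` of `𝕊ⁿ` induced by `T ∈ GL(n+1, ℝ)`. -/
def sphMap {n : ℕ} (T : GL (Fin (n + 1)) ℝ) (x : Sph n) : Sph n :=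
  let Tx := Matrix.toEuclideanLin (T : Matrix (Fin (n + 1)) (Fin (n + 1)) ℝ) x
  ⟨‖Tx‖⁻¹ • Tx, by
    have hT : Tx ≠ 0 := by
      intro h
      have h1 : (T : Matrix (Fin (n + 1)) (Fin (n + 1)) ℝ).mulVec
          (WithLp.ofLp (x : EuclideanSpace ℝ (Fin (n + 1)))) = 0 := by
        have := congrArg WithLp.ofLp h
        simpa [Tx, Matrix.toEuclideanLin] using this
      have h2 : WithLp.ofLp (x : EuclideanSpace ℝ (Fin (n + 1))) = 0 := by
        have h3 := congrArg (Matrix.mulVec ((T⁻¹ : GL (Fin (n + 1)) ℝ) :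
          Matrix (Fin (n + 1)) (Fin (n + 1)) ℝ)) h1
        rw [Matrix.mulVec_mulVec, ← Units.val_mul, inv_mul_cancel] at h3
        simpa using h3
      have h4 : (x : EuclideanSpace ℝ (Fin (n + 1))) = 0 := by
        ext i
        simpa using congrFun h2 i
      have h5 : ‖(x : EuclideanSpace ℝ (Fin (n + 1)))‖ = 1 := by simp
      rw [h4] at h5
      simp at h5
    simp [norm_smul, hT]⟩

/-! ### Real projective space as the quotient of the sphere by the antipodal map -/

/-- `ℤˣ = {±1}` acts on `𝕊ⁿ` by the identity and the antipodal map. -/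
instance instMulActionSph (n : ℕ) : MulAction ℤˣ (Sph n) where
  smul s x := ⟨((s : ℤ) : ℝ) • (x : EuclideanSpace ℝ (Fin (n + 1))), by
    rcases Int.units_eq_one_or s with rfl | rfl <;> simp⟩
  one_smul x := Subtype.ext (by
    change (((1 : ℤˣ) : ℤ) : ℝ) • (x : EuclideanSpace ℝ (Fin (n + 1))) = x
    simp)
  mul_smul s t x := Subtype.ext (by
    change (((s * t : ℤˣ) : ℤ) : ℝ) • (x : EuclideanSpace ℝ (Fin (n + 1))) =
      ((s : ℤ) : ℝ) • ((t : ℤ) : ℝ) • (x : EuclideanSpace ℝ (Fin (n + 1)))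
    rw [smul_smul]
    push_cast
    rfl)

theorem neg_one_smul_sph {n : ℕ} (x : Sph n) : (-1 : ℤˣ) • x = -x := Subtype.ext (by
  change (((-1 : ℤˣ) : ℤ) : ℝ) • (x : EuclideanSpace ℝ (Fin (n + 1))) = -x
  simp)

theorem neg_ne_self_sph {n : ℕ} (x : Sph n) : -x ≠ x :=
  (ne_neg_of_mem_unit_sphere ℝ x).symm

instance (n : ℕ) : IsCancelSMul ℤˣ (Sph n) where
  left_cancel' s _ _ h := MulAction.injective s h
  right_cancel' s t x h := by
    rcases Int.units_eq_one_or s with rfl | rfl <;> rcases Int.units_eq_one_or t with rfl | rfl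
    · rfl
    · rw [one_smul, neg_one_smul_sph] at h
      exact absurd h.symm (neg_ne_self_sph x)
    · rw [one_smul, neg_one_smul_sph] at h
      exact absurd h (neg_ne_self_sph x)
    · rfl

instance (n : ℕ) : ContinuousConstSMul ℤˣ (Sph n) where
  continuous_const_smul s := by
    rcases Int.units_eq_one_or s with rfl | rfl
    · simp only [one_smul]
      exact continuous_id
    · simpa [neg_one_smul_sph] using continuous_neg

instance (n : ℕ) : ProperlyDiscontinuousSMul ℤˣ (Sph n) where
  finite_disjoint_inter_image _ _ := Set.toFinite _

/-- Real projective space `ℝPⁿ`, the quotient of `𝕊ⁿ` by the antipodal map. -/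
abbrev RProj (n : ℕ) : Type := MulAction.orbitRel.Quotient ℤˣ (Sph n)

/-- The projection `π : 𝕊ⁿ → ℝPⁿ`. -/
abbrev projSph (n : ℕ) : Sph n → RProj n := Quotient.mk (MulAction.orbitRel ℤˣ (Sph n))

theorem projSph_eq_iff {n : ℕ} {x y : Sph n} : projSph n x = projSph n y ↔ x = y ∨ x = -y := by
  constructor
  · intro h
    obtain ⟨s, hs⟩ := MulAction.orbitRel_apply.1 (Quotient.exact h)
    rcases Int.units_eq_one_or s with rfl | rfl
    · left; simpa using hs.symm
    · right; simpa [neg_one_smul_sph] using hs.symm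
  · rintro (rfl | rfl)
    · rfl
    · exact Quotient.sound (MulAction.orbitRel_apply.2 ⟨-1, neg_one_smul_sph y⟩)

theorem projSph_neg {n : ℕ} (x : Sph n) : projSph n (-x) = projSph n x :=
  projSph_eq_iff.2 (Or.inr rfl)

/-- Local inverses of the projection differ, near each point, by the identity or the antipodal
map. -/
theorem localInverse_projSph_contMDiffAt {n : ℕ} (hf : IsLocalHomeomorph (projSph n)) (z x : Sph n)
    (hx : projSph n x ∈ (hf.localInverseAt z).source) :
    ContMDiffAt (𝓡 n) (𝓡 n) ω (fun w => hf.localInverseAt z (projSph n w)) x := by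
  set e := hf.localInverseAt z with he
  have key : ∀ σ : Sph n → Sph n, ContMDiff (𝓡 n) (𝓡 n) ω σ →
      (∀ w, projSph n (σ w) = projSph n w) → e (projSph n x) = σ x →
      ContMDiffAt (𝓡 n) (𝓡 n) ω (fun w => e (projSph n w)) x := by
    intro σ hσ hπ hσx
    refine (hσ x).congr_of_eventuallyEq ?_
    have hmem : σ x ∈ e.target := hσx ▸ e.map_source hx
    have h1 : ∀ᶠ w in nhds x, σ w ∈ e.target :=
      hσ.continuous.continuousAt.eventually (e.open_target.mem_nhds hmem)
    filter_upwards [h1] with w hw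
    have h2 : e.symm (σ w) = projSph n (σ w) := by
      rw [he, hf.localInverseAt_symm]
    rw [← hπ w, ← h2, e.right_inv hw]
  rcases projSph_eq_iff.1 (hf.apply_localInverseAt_of_mem hx) with h | h
  · exact key id contMDiff_id (fun _ => rfl) h
  · have : Fact (Module.finrank ℝ (EuclideanSpace ℝ (Fin (n + 1))) = n + 1) :=
      ⟨finrank_euclideanSpace_fin⟩
    exact key (fun w => -w) contMDiff_neg_sphere projSph_neg h

/-- `ℝPⁿ`, with the charts obtained from those of `𝕊ⁿ` through local inverses of the projection,
is an analytic, in particular a smooth, manifold. -/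
instance instIsManifoldRProj (n : ℕ) : IsManifold (𝓡 n) ω (RProj n) := by
  apply isManifold_of_contDiffOn
  rintro _ _ ⟨q, rfl⟩ ⟨q', rfl⟩
  generalize_proofs hf hg hg'
  generalize hg.choose q = z
  generalize hg.choose q' = z'
  change IsLocalHomeomorph (projSph n) at hf
  intro y hy
  apply ContDiffAt.contDiffWithinAt
  simp only [mfld_simps] at hy ⊢
  rw [hf.localInverseAt_symm] at hy ⊢
  obtain ⟨⟨h1, -⟩, h3, h4⟩ := hy
  have e1 : ContMDiffAt (𝓡 n) (𝓡 n) ω (chartAt (EuclideanSpace ℝ (Fin n)) z).symm y :=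
    contMDiffOn_chart_symm.contMDiffAt
      ((chartAt (EuclideanSpace ℝ (Fin n)) z).open_target.mem_nhds h1)
  have e2 := localInverse_projSph_contMDiffAt hf z' _ h3
  have e3 : ContMDiffAt (𝓡 n) (𝓡 n) ω (chartAt (EuclideanSpace ℝ (Fin n)) z')
      (hf.localInverseAt z' (projSph n ((chartAt (EuclideanSpace ℝ (Fin n)) z).symm y))) :=
    contMDiffOn_chart.contMDiffAt
      ((chartAt (EuclideanSpace ℝ (Fin n)) z').open_source.mem_nhds h4)
  have e4 : ContMDiffAt (𝓡 n) (𝓡 n) ω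
      (fun w => chartAt (EuclideanSpace ℝ (Fin n)) z' (hf.localInverseAt z' (projSph n w)))
      ((chartAt (EuclideanSpace ℝ (Fin n)) z).symm y) :=
    ContMDiffAt.comp (g := chartAt (EuclideanSpace ℝ (Fin n)) z')
      (f := fun w => hf.localInverseAt z' (projSph n w)) _ e3 e2
  exact (e4.comp y e1).contDiffAt

/-- The set of Riemannian metrics on `ℝPⁿ` with respect to which all linear projective
`(n-1)`-planes (the images of the equators) are minimal. -/
def MinPlaneMetric (n : ℕ) : Type :=
  {h : RiemMetric n (RProj n) //
    ∀ v : EuclideanSpace ℝ (Fin (n + 1)), v ≠ 0 →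
      IsMinimalHypersurface h (projSph n '' equator v)}

end

/-! The core is the identity g₋ₓ = gₓ, where the tangent spaces at x and -x are both identified with
the hyperplane x^⊥. In the stereographic chart centred at p, the equation ⟨·, v⟩ of an equator
through p is an odd function, so its second derivative vanishes at the centre. Minimality at p then
involves only first derivatives of the metric G: the sum of Γ(eᵢ, eᵢ; ν) is zero for every
orthonormal basis (eᵢ, ν). Writing T(u, v, w) = D_u G(v, w), adding the missing ν-term and
polarising gives (n+1) T(v, v, v) = 2 G(v, v) tr_G T(v, ·, ·) (`cubic_eq_trace`).

The metric is then extended to ℝⁿ⁺¹ minus the origin so that the position vector is a unit normal of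
the sphere (`ambientForm`). Along a great circle γ, whose acceleration is normal, the identity reads
(n+1) q'/q = 2 D'/D, with q = G(γ', γ') and D the determinant of G in the standard basis. Hence
q^(n+1) / D² is constant (`hasDerivAt_speed_pow_div_det`). Going from x to -x yields g₋ₓ = ρ gₓ with
ρ^(n+1) = (D(-x)/D(x))². Proportionality on an n-dimensional space also forces D(-x)/D(x) = ρ^n. So
ρ^(n-1) = 1, and ρ = 1 because n ≥ 2 (`ambientForm_neg`).

The remainder is formal. Mean curvature is natural under local isometries
(`IsMinimalHypersurface.preimage`, `IsMinimalHypersurface.of_preimage`) and φ(T) permutes the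
equators, so GL acts by pull-back. A scalar matrix induces the identity or the antipodal map, which
is an isometry, so the action factors through PGL. The same antipodal invariance makes the metric
descend to ℝPⁿ. -/

noncomputable section

open Filter Topology

/-! ### Derivatives of pulled-back bilinear forms -/

section FormPullback

variable {E E' : Type*} [NormedAddCommGroup E] [NormedSpace ℝ E]
  [NormedAddCommGroup E'] [NormedSpace ℝ E']

/-- The pull-back by `ψ` of a field `G` of bilinear forms. -/
def formPullback (G : E' → E' →L[ℝ] E' →L[ℝ] ℝ) (ψ : E → E') (y : E) : E →L[ℝ] E →L[ℝ] ℝ :=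
  (G (ψ y)).bilinearComp (fderiv ℝ ψ y) (fderiv ℝ ψ y)

@[simp]
theorem formPullback_apply (G : E' → E' →L[ℝ] E' →L[ℝ] ℝ) (ψ : E → E') (y u w : E) :
    formPullback G ψ y u w = G (ψ y) (fderiv ℝ ψ y u) (fderiv ℝ ψ y w) := rfl

theorem ContDiffAt.formPullback {G : E' → E' →L[ℝ] E' →L[ℝ] ℝ} {ψ : E → E'} {y : E}
    (hG : ContDiffAt ℝ ∞ G (ψ y)) (hψ : ContDiffAt ℝ ∞ ψ y) :
    ContDiffAt ℝ ∞ (formPullback G ψ) y := by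
  have h1 : ContDiffAt ℝ ∞ (fun y => G (ψ y)) y := hG.comp y hψ
  have h2 : ContDiffAt ℝ ∞ (fderiv ℝ ψ) y := hψ.fderiv_right (by simp)
  have h3 : ContDiffAt ℝ ∞ (fun y => (ContinuousLinearMap.compL ℝ E E' ℝ).flip (fderiv ℝ ψ y)) y :=
    (ContinuousLinearMap.contDiff _).contDiffAt.comp y h2
  exact h3.clm_comp (h1.clm_comp h2)

-- Product rule with three factors. The two terms in D²ψ are the non-tensorial part of the
-- transformation law of Christoffel symbols.
set_option synthInstance.maxHeartbeats 100000 in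
theorem fderiv_formPullback {G : E' → E' →L[ℝ] E' →L[ℝ] ℝ} {ψ : E → E'} {y : E}
    (hG : ContDiffAt ℝ ∞ G (ψ y)) (hψ : ContDiffAt ℝ ∞ ψ y) (z u w : E) :
    fderiv ℝ (formPullback G ψ) y z u w =
      fderiv ℝ G (ψ y) (fderiv ℝ ψ y z) (fderiv ℝ ψ y u) (fderiv ℝ ψ y w) +
      G (ψ y) (fderiv ℝ (fderiv ℝ ψ) y z u) (fderiv ℝ ψ y w) +
      G (ψ y) (fderiv ℝ ψ y u) (fderiv ℝ (fderiv ℝ ψ) y z w) := by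
  have h2 : HasFDerivAt (fderiv ℝ ψ) (fderiv ℝ (fderiv ℝ ψ) y) y :=
    ((hψ.fderiv_right (m := ∞) (by simp)).differentiableAt (by simp)).hasFDerivAt
  have h1 : HasFDerivAt (fun y => G (ψ y)) (fderiv ℝ G (ψ y) ∘L fderiv ℝ ψ y) y :=
    (hG.differentiableAt (by simp)).hasFDerivAt.comp y (hψ.differentiableAt (by simp)).hasFDerivAt
  have hP : HasFDerivAt (formPullback G ψ) (fderiv ℝ (formPullback G ψ) y) y :=
    ((hG.formPullback hψ).differentiableAt (by simp)).hasFDerivAt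
  have h3 := (hP.clm_apply (hasFDerivAt_const u y)).clm_apply (hasFDerivAt_const w y)
  have h4 := (h1.clm_apply (h2.clm_apply (hasFDerivAt_const u y))).clm_apply
    (h2.clm_apply (hasFDerivAt_const w y))
  have h5 := DFunLike.congr_fun (h3.unique h4) z
  simp at h5
  rw [h5]
  ring

/-- A linear isomorphism brings a positive definite form to another one. -/
theorem ContinuousLinearMap.inverse_apply_eq_iff_of_pos [FiniteDimensional ℝ E]
    {B : E →L[ℝ] E →L[ℝ] ℝ} (hB : ∀ v, v ≠ 0 → 0 < B v v) (c : E →L[ℝ] ℝ) (u : E) :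
    B.inverse c = u ↔ B u = c := by
  have hinj : Function.Injective (B : E →ₗ[ℝ] (E →L[ℝ] ℝ)) := by
    rw [← LinearMap.ker_eq_bot, LinearMap.ker_eq_bot']
    intro v hv
    by_contra hne
    have h1 := hB v hne
    have h2 : B v = 0 := hv
    simp [h2] at h1
  have hfin : Module.finrank ℝ E = Module.finrank ℝ (E →L[ℝ] ℝ) := by
    rw [← (LinearMap.toContinuousLinearMap (𝕜 := ℝ) (E := E) (F' := ℝ)).finrank_eq]
    exact (Subspace.dual_finrank_eq (K := ℝ) (V := E)).symm
  -- Definiteness makes `B` an isomorphism onto the dual, so `inverse` is a true inverse and not its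
  -- default value 0.
  let e : E ≃L[ℝ] (E →L[ℝ] ℝ) :=
    (LinearEquiv.ofInjectiveOfFinrankEq (B : E →ₗ[ℝ] (E →L[ℝ] ℝ)) hinj
      hfin).toContinuousLinearEquiv
  have he : B = (e : E →L[ℝ] (E →L[ℝ] ℝ)) := rfl
  rw [he, ContinuousLinearMap.inverse_equiv]
  constructor
  · rintro rfl
    simp
  · rintro rfl
    simp

end FormPullback

/-! ### Coordinate invariance of the mean curvature -/

section ChartNaturality

variable {n : ℕ} {G G' : EuclideanSpace ℝ (Fin n) →
    EuclideanSpace ℝ (Fin n) →L[ℝ] EuclideanSpace ℝ (Fin n) →L[ℝ] ℝ}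
  {F F' : EuclideanSpace ℝ (Fin n) → ℝ} {y : EuclideanSpace ℝ (Fin n)}
  {ψ : EuclideanSpace ℝ (Fin n) → EuclideanSpace ℝ (Fin n)}

theorem christoffelFirst_apply (u v w : EuclideanSpace ℝ (Fin n)) :
    christoffelFirst G y u v w =
      (1 / 2) * (fderiv ℝ G y u v w + fderiv ℝ G y v u w - fderiv ℝ G y w u v) := by
  simp [christoffelFirst]

/-- Of the six terms in D²ψ, four cancel by symmetry of D²ψ and of G; the other two are equal and
absorb the factor 1/2. -/
theorem christoffelFirst_formPullback (hG : ContDiffAt ℝ ∞ G (ψ y)) (hψ : ContDiffAt ℝ ∞ ψ y)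
    (hsymm : ∀ u v, G (ψ y) u v = G (ψ y) v u) (u v w : EuclideanSpace ℝ (Fin n)) :
    christoffelFirst (formPullback G ψ) y u v w =
      christoffelFirst G (ψ y) (fderiv ℝ ψ y u) (fderiv ℝ ψ y v) (fderiv ℝ ψ y w) +
        G (ψ y) (fderiv ℝ (fderiv ℝ ψ) y u v) (fderiv ℝ ψ y w) := by
  have hs : ∀ a b, fderiv ℝ (fderiv ℝ ψ) y a b = fderiv ℝ (fderiv ℝ ψ) y b a :=
    hψ.isSymmSndFDerivAt (by rw [minSmoothness_of_isRCLikeNormedField]; exact WithTop.coe_le_coe.2 (le_top : (2 : ℕ∞) ≤ ⊤))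
  simp only [christoffelFirst_apply, fderiv_formPullback hG hψ]
  rw [hs v u, hs w u, hs w v, hsymm (fderiv ℝ ψ y v), hsymm (fderiv ℝ ψ y u)]
  ring

/-- The term DF(D²ψ(u, v)) of the second-order chain rule cancels against the inhomogeneous term of
the Christoffel symbols. -/
theorem chartHessian_formPullback (hG : ContDiffAt ℝ ∞ G (ψ y)) (hψ : ContDiffAt ℝ ∞ ψ y)
    (hF : ContDiffAt ℝ ∞ F (ψ y)) (hsymm : ∀ u v, G (ψ y) u v = G (ψ y) v u)
    (hpos : ∀ v, v ≠ 0 → 0 < G (ψ y) v v)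
    (L : EuclideanSpace ℝ (Fin n) ≃L[ℝ] EuclideanSpace ℝ (Fin n))
    (hL : fderiv ℝ ψ y = L) (u v : EuclideanSpace ℝ (Fin n)) :
    chartHessian (formPullback G ψ) (F ∘ ψ) y u v = chartHessian G F (ψ y) (L u) (L v) := by
  have hpos' : ∀ v, v ≠ 0 → 0 < formPullback G ψ y v v := fun v hv => by
    rw [formPullback_apply, hL]
    exact hpos _ (by simpa using hv)
  have hGamma : christoffelSecond (formPullback G ψ) y u v =
      L.symm (christoffelSecond G (ψ y) (L u) (L v) + fderiv ℝ (fderiv ℝ ψ) y u v) := by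
    rw [christoffelSecond, ContinuousLinearMap.inverse_apply_eq_iff_of_pos hpos']
    ext w
    rw [formPullback_apply, christoffelFirst_formPullback hG hψ hsymm, hL]
    simp only [ContinuousLinearEquiv.coe_coe, ContinuousLinearEquiv.apply_symm_apply, map_add,
      add_apply]
    congr 1
    exact DFunLike.congr_fun ((ContinuousLinearMap.inverse_apply_eq_iff_of_pos hpos _ _).1 rfl) _
  have hd : ∀ᶠ x in 𝓝 y, fderiv ℝ (F ∘ ψ) x = (fderiv ℝ F (ψ x)) ∘L (fderiv ℝ ψ x) := by
    have h1 : ∀ᶠ x in 𝓝 y, ContDiffAt ℝ 1 ψ x := (hψ.of_le (by simp)).eventually (by simp)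
    have h2 : ∀ᶠ x in 𝓝 (ψ y), ContDiffAt ℝ 1 F x := (hF.of_le (by simp)).eventually (by simp)
    filter_upwards [h1, hψ.continuousAt.eventually h2] with x hx1 hx2
    exact fderiv_comp x (hx2.differentiableAt (by simp)) (hx1.differentiableAt (by simp))
  have h2 : HasFDerivAt (fderiv ℝ ψ) (fderiv ℝ (fderiv ℝ ψ) y) y :=
    ((hψ.fderiv_right (m := ∞) (by simp)).differentiableAt (by simp)).hasFDerivAt
  have h1 : HasFDerivAt (fun y => fderiv ℝ F (ψ y))
      (fderiv ℝ (fderiv ℝ F) (ψ y) ∘L fderiv ℝ ψ y) y :=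
    ((hF.fderiv_right (m := ∞) (by simp)).differentiableAt (by simp)).hasFDerivAt.comp y
      (hψ.differentiableAt (by simp)).hasFDerivAt
  have h3 := h1.clm_comp h2
  rw [chartHessian, chartHessian, Filter.EventuallyEq.fderiv_eq hd, h3.fderiv, hd.self_of_nhds,
    hGamma]
  simp [hL]
  ring

theorem chartSecondFundamentalForm_formPullback (hG : ContDiffAt ℝ ∞ G (ψ y))
    (hψ : ContDiffAt ℝ ∞ ψ y)
    (hF : ContDiffAt ℝ ∞ F (ψ y)) (hsymm : ∀ u v, G (ψ y) u v = G (ψ y) v u)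
    (hpos : ∀ v, v ≠ 0 → 0 < G (ψ y) v v)
    (L : EuclideanSpace ℝ (Fin n) ≃L[ℝ] EuclideanSpace ℝ (Fin n))
    (hL : fderiv ℝ ψ y = L) (u v : EuclideanSpace ℝ (Fin n)) :
    chartSecondFundamentalForm (formPullback G ψ) (F ∘ ψ) y u v =
      chartSecondFundamentalForm G F (ψ y) (L u) (L v) := by
  have hpos' : ∀ v, v ≠ 0 → 0 < formPullback G ψ y v v := fun v hv => by
    rw [formPullback_apply, hL]
    exact hpos _ (by simpa using hv)
  have hgrad : chartGradient (formPullback G ψ) (F ∘ ψ) y = L.symm (chartGradient G F (ψ y)) := by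
    rw [chartGradient, ContinuousLinearMap.inverse_apply_eq_iff_of_pos hpos']
    ext w
    rw [formPullback_apply, hL, fderiv_comp y (hF.differentiableAt (by simp))
      (hψ.differentiableAt (by simp)), hL]
    simp only [ContinuousLinearEquiv.coe_coe, ContinuousLinearEquiv.apply_symm_apply]
    exact DFunLike.congr_fun ((ContinuousLinearMap.inverse_apply_eq_iff_of_pos hpos _ _).1 rfl) _
  rw [chartSecondFundamentalForm, chartSecondFundamentalForm,
    chartHessian_formPullback hG hψ hF hsymm hpos L hL, hgrad, formPullback_apply, hL]
  simp

/-- The differential of ψ matches the orthonormal bases of the two tangent hyperplanes, and the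
second fundamental forms correspond. -/
theorem chartMeanCurvatureVanishes_formPullback_iff (hG : ContDiffAt ℝ ∞ G (ψ y))
    (hψ : ContDiffAt ℝ ∞ ψ y)
    (hF : ContDiffAt ℝ ∞ F (ψ y)) (hsymm : ∀ u v, G (ψ y) u v = G (ψ y) v u)
    (hpos : ∀ v, v ≠ 0 → 0 < G (ψ y) v v) (hL : (fderiv ℝ ψ y).IsInvertible) :
    ChartMeanCurvatureVanishes (formPullback G ψ) (F ∘ ψ) y ↔
      ChartMeanCurvatureVanishes G F (ψ y) := by
  obtain ⟨L, hL⟩ := hL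
  have hdF : ∀ u, fderiv ℝ (F ∘ ψ) y u = fderiv ℝ F (ψ y) (L u) := fun u => by
    rw [fderiv_comp y (hF.differentiableAt (by simp)) (hψ.differentiableAt (by simp)), ← hL]
    rfl
  have hform := chartSecondFundamentalForm_formPullback hG hψ hF hsymm hpos L hL.symm
  constructor
  · intro h e he1 he2
    have := h (fun i => L.symm (e i)) (fun i => by rw [hdF]; simpa using he1 i)
      (fun i j => by rw [formPullback_apply, ← hL]; simpa using he2 i j)
    simpa [hform] using this
  · intro h e he1 he2
    have := h (fun i => L (e i)) (fun i => by rw [← hdF]; exact he1 i)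
      (fun i j => by rw [← he2 i j, formPullback_apply, ← hL]; rfl)
    simpa [hform] using this

/-- The condition depends only on G to first order and F to second order at `y`. -/
theorem ChartMeanCurvatureVanishes.congr (h : ChartMeanCurvatureVanishes G F y)
    (hG : G' =ᶠ[𝓝 y] G) (hF : F' =ᶠ[𝓝 y] F) : ChartMeanCurvatureVanishes G' F' y := by
  simp only [ChartMeanCurvatureVanishes, chartSecondFundamentalForm, chartHessian, chartGradient,
    christoffelSecond, christoffelFirst] at h ⊢
  rw [hG.fderiv_eq, hF.fderiv.fderiv_eq, hF.fderiv_eq, hG.self_of_nhds]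
  exact h

end ChartNaturality

end

noncomputable section

open Filter Topology Bundle

/-! ### Bilinear form fields on manifolds, read in charts -/

section ChartForm

variable {m n : ℕ}
  {M : Type*} [TopologicalSpace M] [ChartedSpace (EuclideanSpace ℝ (Fin m)) M]
  [IsManifold (𝓡 m) ∞ M]
  {N : Type*} [TopologicalSpace N] [ChartedSpace (EuclideanSpace ℝ (Fin n)) N]
  [IsManifold (𝓡 n) ∞ N]

/-- A field of bilinear forms on the tangent spaces, read in the preferred chart at `p`. -/
def chartForm (b : ∀ x : M, TangentSpace (𝓡 m) x →L[ℝ] TangentSpace (𝓡 m) x →L[ℝ] ℝ) (p : M)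
    (y : EuclideanSpace ℝ (Fin m)) :
    EuclideanSpace ℝ (Fin m) →L[ℝ] EuclideanSpace ℝ (Fin m) →L[ℝ] ℝ :=
  let L : EuclideanSpace ℝ (Fin m) →L[ℝ] EuclideanSpace ℝ (Fin m) :=
    mfderiv 𝓘(ℝ, EuclideanSpace ℝ (Fin m)) (𝓡 m) (extChartAt (𝓡 m) p).symm y
  let B : EuclideanSpace ℝ (Fin m) →L[ℝ] EuclideanSpace ℝ (Fin m) →L[ℝ] ℝ :=
    b ((extChartAt (𝓡 m) p).symm y)
  B.bilinearComp L L

omit [IsManifold (𝓡 m) ∞ M] in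
theorem chartForm_apply (b : ∀ x : M, TangentSpace (𝓡 m) x →L[ℝ] TangentSpace (𝓡 m) x →L[ℝ] ℝ)
    (p : M) (y u v : EuclideanSpace ℝ (Fin m)) :
    chartForm b p y u v = b ((extChartAt (𝓡 m) p).symm y)
      (mfderiv 𝓘(ℝ, EuclideanSpace ℝ (Fin m)) (𝓡 m) (extChartAt (𝓡 m) p).symm y u)
      (mfderiv 𝓘(ℝ, EuclideanSpace ℝ (Fin m)) (𝓡 m) (extChartAt (𝓡 m) p).symm y v) := rfl

theorem mdifferentiableAt_extChartAt_symm_of_mem {p : M} {y : EuclideanSpace ℝ (Fin m)}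
    (hy : y ∈ (extChartAt (𝓡 m) p).target) :
    MDifferentiableAt 𝓘(ℝ, EuclideanSpace ℝ (Fin m)) (𝓡 m) (extChartAt (𝓡 m) p).symm y := by
  have : IsManifold (𝓡 m) 1 M := IsManifold.of_le (n := ∞) (by simp)
  have := mdifferentiableWithinAt_extChartAt_symm (I := 𝓡 m) hy
  rwa [modelWithCornersSelf_coe, Set.range_id, mdifferentiableWithinAt_univ] at this

theorem chartForm_mfderiv_extChartAt
    (b : ∀ x : M, TangentSpace (𝓡 m) x →L[ℝ] TangentSpace (𝓡 m) x →L[ℝ] ℝ)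
    (p q : M) (hq : q ∈ (extChartAt (𝓡 m) p).source) (u v : TangentSpace (𝓡 m) q) :
    chartForm b p (extChartAt (𝓡 m) p q)
      (mfderiv (𝓡 m) 𝓘(ℝ, EuclideanSpace ℝ (Fin m)) (extChartAt (𝓡 m) p) q u)
      (mfderiv (𝓡 m) 𝓘(ℝ, EuclideanSpace ℝ (Fin m)) (extChartAt (𝓡 m) p) q v) = b q u v := by
  have : IsManifold (𝓡 m) 1 M := IsManifold.of_le (n := ∞) (by simp)
  have h := mfderivWithin_extChartAt_symm_comp_mfderiv_extChartAt' (I := 𝓡 m) hq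
  simp only [modelWithCornersSelf_coe, Set.range_id, mfderivWithin_univ] at h
  have h' : ∀ u, mfderiv 𝓘(ℝ, EuclideanSpace ℝ (Fin m)) (𝓡 m) (extChartAt (𝓡 m) p).symm
      (extChartAt (𝓡 m) p q)
      (mfderiv (𝓡 m) 𝓘(ℝ, EuclideanSpace ℝ (Fin m)) (extChartAt (𝓡 m) p) q u) = u :=
    fun u => DFunLike.congr_fun h u
  change b _ (mfderiv 𝓘(ℝ, EuclideanSpace ℝ (Fin m)) (𝓡 m) (extChartAt (𝓡 m) p).symm
      (extChartAt (𝓡 m) p q)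
      (mfderiv (𝓡 m) 𝓘(ℝ, EuclideanSpace ℝ (Fin m)) (extChartAt (𝓡 m) p) q u))
      (mfderiv 𝓘(ℝ, EuclideanSpace ℝ (Fin m)) (𝓡 m) (extChartAt (𝓡 m) p).symm
      (extChartAt (𝓡 m) p q)
      (mfderiv (𝓡 m) 𝓘(ℝ, EuclideanSpace ℝ (Fin m)) (extChartAt (𝓡 m) p) q v)) = _
  rw [h', h']
  rw [(extChartAt (𝓡 m) p).left_inv hq]

/-- In the trivialization of the tangent bundle at `p`, the coordinates of a section are those given
by the differential of the inverse chart. Smoothness of metrics thus becomes a question in Euclidean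
space. -/
theorem contMDiffAt_section_iff_chartForm
    (b : ∀ x : M, TangentSpace (𝓡 m) x →L[ℝ] TangentSpace (𝓡 m) x →L[ℝ] ℝ) (p : M) :
    ContMDiffAt (𝓡 m) ((𝓡 m).prod 𝓘(ℝ, EuclideanSpace ℝ (Fin m) →L[ℝ]
        EuclideanSpace ℝ (Fin m) →L[ℝ] ℝ)) ∞
      (fun x : M => TotalSpace.mk' (EuclideanSpace ℝ (Fin m) →L[ℝ] EuclideanSpace ℝ (Fin m) →L[ℝ] ℝ)
        (E := fun x : M => TangentSpace (𝓡 m) x →L[ℝ] TangentSpace (𝓡 m) x →L[ℝ] ℝ) x (b x)) p ↔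
      ContDiffAt ℝ ∞ (chartForm b p) (extChartAt (𝓡 m) p p) := by
  have : IsManifold (𝓡 m) 1 M := IsManifold.of_le (n := ∞) (by simp)
  rw [contMDiffAt_hom_bundle]
  have key : (fun x => ContinuousLinearMap.inCoordinates (EuclideanSpace ℝ (Fin m))
      (fun x : M => TangentSpace (𝓡 m) x) (EuclideanSpace ℝ (Fin m) →L[ℝ] ℝ)
      (fun x : M => TangentSpace (𝓡 m) x →L[ℝ] ℝ) p x p x (b x)) =ᶠ[𝓝 p]
      fun x => chartForm b p (extChartAt (𝓡 m) p x) := by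
    filter_upwards [extChartAt_source_mem_nhds (I := 𝓡 m) p] with q hq
    have hq' : q ∈ (chartAt (EuclideanSpace ℝ (Fin m)) p).source := by simpa using hq
    have hs := TangentBundle.symmL_trivializationAt (𝕜 := ℝ) (I := 𝓡 m) hq'
    simp only [modelWithCornersSelf_coe, Set.range_id, mfderivWithin_univ] at hs
    ext u v
    rw [inCoordinates_apply_eq₂ (E₃ := fun _ : M => ℝ) (by simpa using hq') (by simpa using hq')
      (Set.mem_univ _), chartForm_apply]
    have hs' : ∀ u, (trivializationAt (EuclideanSpace ℝ (Fin m)) (TangentSpace (𝓡 m)) p).symm q u =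
      mfderiv 𝓘(ℝ, EuclideanSpace ℝ (Fin m)) (𝓡 m) (extChartAt (𝓡 m) p).symm
        (extChartAt (𝓡 m) p q) u := fun u => by
      rw [← hs]
      exact (Trivialization.symmL_apply (R := ℝ) _ (by simpa using hq') _).symm
    simp only [Trivial.fiberBundle_trivializationAt', Trivial.linearMapAt_trivialization,
        LinearMap.id_coe, id_eq]
    rw [hs', hs']
    rw [(extChartAt (𝓡 m) p).left_inv hq]
  constructor
  · rintro ⟨-, h⟩
    have h2 := h.congr_of_eventuallyEq key.symm
    have h3 : ContMDiffAt 𝓘(ℝ, EuclideanSpace ℝ (Fin m)) (𝓡 m) ∞ (extChartAt (𝓡 m) p).symm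
        (extChartAt (𝓡 m) p p) :=
      (contMDiffOn_extChartAt_symm p).contMDiffAt (extChartAt_target_mem_nhds p)
    have h4 := ContMDiffAt.comp_of_eq h2 h3 (extChartAt_to_inv p)
    refine (h4.contDiffAt).congr_of_eventuallyEq ?_
    filter_upwards [extChartAt_target_mem_nhds (I := 𝓡 m) p] with y hy
    simp only [Function.comp_apply]
    rw [(extChartAt (𝓡 m) p).right_inv hy]
  · intro h
    refine ⟨contMDiffAt_id, ContMDiffAt.congr_of_eventuallyEq ?_ key⟩
    exact h.contMDiffAt.comp p contMDiffAt_extChartAt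

theorem RiemMetric.contDiffAt_metricInChart (g : RiemMetric n N) (p : N) :
    ContDiffAt ℝ ∞ (metricInChart g p) (extChartAt (𝓡 n) p p) :=
  (contMDiffAt_section_iff_chartForm g.inner p).1 (g.contMDiff p)

theorem RiemMetric.metricInChart_symm (g : RiemMetric n N) (p : N)
    (y u v : EuclideanSpace ℝ (Fin n)) : metricInChart g p y u v = metricInChart g p y v u :=
  g.symm _ _ _

theorem RiemMetric.metricInChart_pos (g : RiemMetric n N) (p : N) {y : EuclideanSpace ℝ (Fin n)}
    (hy : y ∈ (extChartAt (𝓡 n) p).target) (v : EuclideanSpace ℝ (Fin n)) (hv : v ≠ 0) :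
    0 < metricInChart g p y v v := by
  have : IsManifold (𝓡 n) 1 N := IsManifold.of_le (n := ∞) (by simp)
  refine g.pos _ _ ?_
  have h := mfderiv_extChartAt_comp_mfderivWithin_extChartAt_symm (I := 𝓡 n) hy
  simp only [modelWithCornersSelf_coe, Set.range_id, mfderivWithin_univ] at h
  intro h0
  have h1 := DFunLike.congr_fun h v
  apply hv
  change mfderiv (𝓡 n) 𝓘(ℝ, EuclideanSpace ℝ (Fin n)) (extChartAt (𝓡 n) p)
    ((extChartAt (𝓡 n) p).symm y)
    (mfderiv 𝓘(ℝ, EuclideanSpace ℝ (Fin n)) (𝓡 n) (extChartAt (𝓡 n) p).symm y v) = v at h1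
  rw [← h1]
  exact (congrArg _ h0).trans (map_zero _)

/-- The hypotheses are local at `p` so that φ may be a local inverse of the projection or the radial
retraction; the latter is why the dimensions may differ. -/
theorem chartForm_pullback_eventuallyEq {φ : M → N} {p : M}
    (hφ : ContMDiffAt (𝓡 m) (𝓡 n) ∞ φ p)
    {b : ∀ x : N, TangentSpace (𝓡 n) x →L[ℝ] TangentSpace (𝓡 n) x →L[ℝ] ℝ}
    {b' : ∀ x : M, TangentSpace (𝓡 m) x →L[ℝ] TangentSpace (𝓡 m) x →L[ℝ] ℝ}
    (hb : ∀ᶠ x in 𝓝 p, ∀ u v, b' x u v =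
      b (φ x) (mfderiv (𝓡 m) (𝓡 n) φ x u) (mfderiv (𝓡 m) (𝓡 n) φ x v)) :
    chartForm b' p =ᶠ[𝓝 (extChartAt (𝓡 m) p p)]
      formPullback (chartForm b (φ p))
        (extChartAt (𝓡 n) (φ p) ∘ φ ∘ (extChartAt (𝓡 m) p).symm) := by
  have : IsManifold (𝓡 m) 1 M := IsManifold.of_le (n := ∞) (by simp)
  have : IsManifold (𝓡 n) 1 N := IsManifold.of_le (n := ∞) (by simp)
  have h1 : ∀ᶠ x in 𝓝 p, ContMDiffAt (𝓡 m) (𝓡 n) 1 φ x :=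
    (contMDiffAt_iff_contMDiffAt_nhds (by simp)).1 (ContMDiffAt.of_le hφ (by simp))
  have h2 : ∀ᶠ x in 𝓝 p, φ x ∈ (extChartAt (𝓡 n) (φ p)).source :=
    hφ.continuousAt.eventually (extChartAt_source_mem_nhds (I := 𝓡 n) (φ p))
  have hc : Tendsto (extChartAt (𝓡 m) p).symm (𝓝 (extChartAt (𝓡 m) p p)) (𝓝 p) := by
    have := continuousAt_extChartAt_symm (I := 𝓡 m) p
    rwa [ContinuousAt, extChartAt_to_inv] at this
  filter_upwards [hc.eventually h1, hc.eventually h2, hc.eventually hb,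
    extChartAt_target_mem_nhds (I := 𝓡 m) p] with y hy1 hy2 hy3 hy4
  have hd1 := mdifferentiableAt_extChartAt_symm_of_mem hy4
  have hd2 := hy1.mdifferentiableAt (by simp)
  have hd3 : MDifferentiableAt (𝓡 n) 𝓘(ℝ, EuclideanSpace ℝ (Fin n)) (extChartAt (𝓡 n) (φ p))
      (φ ((extChartAt (𝓡 m) p).symm y)) := mdifferentiableAt_extChartAt (by simpa using hy2)
  have hd : ∀ u, fderiv ℝ (extChartAt (𝓡 n) (φ p) ∘ φ ∘ (extChartAt (𝓡 m) p).symm) y u =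
      mfderiv (𝓡 n) 𝓘(ℝ, EuclideanSpace ℝ (Fin n)) (extChartAt (𝓡 n) (φ p))
        (φ ((extChartAt (𝓡 m) p).symm y))
      (mfderiv (𝓡 m) (𝓡 n) φ ((extChartAt (𝓡 m) p).symm y)
      (mfderiv 𝓘(ℝ, EuclideanSpace ℝ (Fin m)) (𝓡 m) (extChartAt (𝓡 m) p).symm y u)) := by
    intro u
    rw [← mfderiv_eq_fderiv]
    rw [mfderiv_comp y hd3 (hd2.comp y hd1), mfderiv_comp y hd2 hd1]
    rfl
  ext u v
  rw [formPullback_apply, hd, hd, chartForm_apply, hy3]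
  exact (chartForm_mfderiv_extChartAt b (φ p) _ hy2 _ _).symm

omit [IsManifold (𝓡 m) ∞ M] [IsManifold (𝓡 n) ∞ N] in
theorem ContMDiffAt.contDiffAt_extChartAt {φ : M → N} {p : M}
    (hφ : ContMDiffAt (𝓡 m) (𝓡 n) ∞ φ p) :
    ContDiffAt ℝ ∞ (extChartAt (𝓡 n) (φ p) ∘ φ ∘ (extChartAt (𝓡 m) p).symm)
      (extChartAt (𝓡 m) p p) := by
  have := (contMDiffAt_iff.1 hφ).2
  rwa [modelWithCornersSelf_coe, Set.range_id, contDiffWithinAt_univ] at this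

theorem contMDiffAt_section_pullback {φ : M → N} {p : M}
    (hφ : ContMDiffAt (𝓡 m) (𝓡 n) ∞ φ p)
    {b : ∀ x : N, TangentSpace (𝓡 n) x →L[ℝ] TangentSpace (𝓡 n) x →L[ℝ] ℝ}
    {b' : ∀ x : M, TangentSpace (𝓡 m) x →L[ℝ] TangentSpace (𝓡 m) x →L[ℝ] ℝ}
    (hb : ∀ᶠ x in 𝓝 p, ∀ u v, b' x u v =
      b (φ x) (mfderiv (𝓡 m) (𝓡 n) φ x u) (mfderiv (𝓡 m) (𝓡 n) φ x v))
    (hs : ContMDiffAt (𝓡 n) ((𝓡 n).prod 𝓘(ℝ, EuclideanSpace ℝ (Fin n) →L[ℝ]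
        EuclideanSpace ℝ (Fin n) →L[ℝ] ℝ)) ∞
      (fun x : N => TotalSpace.mk' (EuclideanSpace ℝ (Fin n) →L[ℝ] EuclideanSpace ℝ (Fin n) →L[ℝ] ℝ)
        (E := fun x : N => TangentSpace (𝓡 n) x →L[ℝ] TangentSpace (𝓡 n) x →L[ℝ] ℝ) x (b x))
        (φ p)) :
    ContMDiffAt (𝓡 m) ((𝓡 m).prod 𝓘(ℝ, EuclideanSpace ℝ (Fin m) →L[ℝ]
        EuclideanSpace ℝ (Fin m) →L[ℝ] ℝ)) ∞
      (fun x : M => TotalSpace.mk' (EuclideanSpace ℝ (Fin m) →L[ℝ] EuclideanSpace ℝ (Fin m) →L[ℝ] ℝ)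
        (E := fun x : M => TangentSpace (𝓡 m) x →L[ℝ] TangentSpace (𝓡 m) x →L[ℝ] ℝ) x (b' x)) p := by
  rw [contMDiffAt_section_iff_chartForm] at hs ⊢
  refine (ContDiffAt.formPullback ?_ hφ.contDiffAt_extChartAt).congr_of_eventuallyEq
    (chartForm_pullback_eventuallyEq hφ hb)
  simpa using hs

end ChartForm

/-! ### Pull-back of Riemannian metrics -/

section PullbackMetric

variable {n : ℕ}
  {M : Type*} [TopologicalSpace M] [ChartedSpace (EuclideanSpace ℝ (Fin n)) M]
  [IsManifold (𝓡 n) ∞ M]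
  {N : Type*} [TopologicalSpace N] [ChartedSpace (EuclideanSpace ℝ (Fin n)) N]
  [IsManifold (𝓡 n) ∞ N]

theorem RiemMetric.ext' {g g' : RiemMetric n M} (h : ∀ x u v, g.inner x u v = g'.inner x u v) :
    g = g' := by
  have h1 : g.inner = g'.inner := by
    funext x
    ext u v
    exact h x u v
  cases g
  cases g'
  congr

theorem IsPullback.unique {φ : M → N} {g : RiemMetric n N} {g₁ g₂ : RiemMetric n M}
    (h₁ : IsPullback φ g g₁) (h₂ : IsPullback φ g g₂) : g₁ = g₂ :=
  RiemMetric.ext' fun x u v => by rw [h₁.2, h₂.2]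

/-- A bilinear form at each point of `M`, isometric to a Riemannian metric at some point of another
manifold and smooth in the base point, is a Riemannian metric. -/
def RiemMetric.ofIsometric (g : RiemMetric n N)
    (b : ∀ x : M, TangentSpace (𝓡 n) x →L[ℝ] TangentSpace (𝓡 n) x →L[ℝ] ℝ)
    (f : M → N) (L : ∀ x : M, TangentSpace (𝓡 n) x ≃L[ℝ] TangentSpace (𝓡 n) (f x))
    (hb : ∀ x u v, b x u v = g.inner (f x) (L x u) (L x v))
    (hs : ContMDiff (𝓡 n) ((𝓡 n).prod 𝓘(ℝ, EuclideanSpace ℝ (Fin n) →L[ℝ]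
        EuclideanSpace ℝ (Fin n) →L[ℝ] ℝ)) ∞
      (fun x : M => TotalSpace.mk' (EuclideanSpace ℝ (Fin n) →L[ℝ] EuclideanSpace ℝ (Fin n) →L[ℝ] ℝ)
        (E := fun x : M => TangentSpace (𝓡 n) x →L[ℝ] TangentSpace (𝓡 n) x →L[ℝ] ℝ) x (b x))) :
    RiemMetric n M where
  inner := b
  symm x u v := by rw [hb, hb, g.symm]
  pos x v hv := by
    rw [hb]
    exact g.pos _ _ (by simpa using hv)
  isVonNBounded x := by
    -- The unit ball of `b x` lies in the image under the inverse of `L x` of the unit ball of `g`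
    -- at `f x`.
    refine ((g.isVonNBounded (f x)).image
      ((L x).symm : TangentSpace (𝓡 n) (f x) →L[ℝ] TangentSpace (𝓡 n) x)).subset ?_
    intro v hv
    exact ⟨L x v, by simpa [hb] using hv, by simp⟩
  contMDiff := hs

/-- The pull-back of a Riemannian metric by a local diffeomorphism. -/
def RiemMetric.pullback (g : RiemMetric n N) (φ : M → N)
    (hφ : IsLocalDiffeomorph (𝓡 n) (𝓡 n) ∞ φ) : RiemMetric n M :=
  RiemMetric.ofIsometric g
    (fun x =>
      let L : EuclideanSpace ℝ (Fin n) →L[ℝ] EuclideanSpace ℝ (Fin n) := mfderiv (𝓡 n) (𝓡 n) φ x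
      let B : EuclideanSpace ℝ (Fin n) →L[ℝ] EuclideanSpace ℝ (Fin n) →L[ℝ] ℝ := g.inner (φ x)
      B.bilinearComp L L) φ
    (fun x => hφ.mfderivToContinuousLinearEquiv (by simp) x) (fun _ _ _ => rfl)
    (fun x => contMDiffAt_section_pullback (hφ.contMDiff x)
      (Eventually.of_forall fun _ _ _ => rfl) (g.contMDiff _))

theorem RiemMetric.isPullback_pullback (g : RiemMetric n N) (φ : M → N)
    (hφ : IsLocalDiffeomorph (𝓡 n) (𝓡 n) ∞ φ) : IsPullback φ g (g.pullback φ hφ) :=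
  ⟨hφ.contMDiff, fun _ _ _ => rfl⟩

end PullbackMetric

end

noncomputable section

open Filter Topology Bundle

/-! ### Minimal hypersurfaces under local isometries -/

section MinimalNaturality

variable {n : ℕ}
  {M : Type*} [TopologicalSpace M] [ChartedSpace (EuclideanSpace ℝ (Fin n)) M]
  [IsManifold (𝓡 n) ∞ M]
  {N : Type*} [TopologicalSpace N] [ChartedSpace (EuclideanSpace ℝ (Fin n)) N]
  [IsManifold (𝓡 n) ∞ N]

omit [IsManifold (𝓡 n) ∞ M] [IsManifold (𝓡 n) ∞ N] in
theorem fderiv_extChartAt_comp_extChartAt_symm {φ : M → N} {p : M}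
    (hφ : MDifferentiableAt (𝓡 n) (𝓡 n) φ p) (u : EuclideanSpace ℝ (Fin n)) :
    fderiv ℝ (extChartAt (𝓡 n) (φ p) ∘ φ ∘ (extChartAt (𝓡 n) p).symm) (extChartAt (𝓡 n) p p) u =
      mfderiv (𝓡 n) (𝓡 n) φ p u := by
  rw [hφ.mfderiv]
  simp only [writtenInExtChartAt, modelWithCornersSelf_coe, Set.range_id, fderivWithin_univ]
  rfl

omit [IsManifold (𝓡 n) ∞ M] [IsManifold (𝓡 n) ∞ N] in
theorem IsLocalDiffeomorphAt.isInvertible_fderiv_extChartAt {φ : M → N} {p : M}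
    (hφ : IsLocalDiffeomorphAt (𝓡 n) (𝓡 n) ∞ φ p) :
    (fderiv ℝ (extChartAt (𝓡 n) (φ p) ∘ φ ∘ (extChartAt (𝓡 n) p).symm)
      (extChartAt (𝓡 n) p p)).IsInvertible := by
  refine ⟨hφ.mfderivToContinuousLinearEquiv (by simp), ?_⟩
  ext1 u
  exact (fderiv_extChartAt_comp_extChartAt_symm (hφ.mdifferentiableAt (by simp)) u).symm

/-- Read in preferred charts, φ is a change of coordinates and the metric above is the pull-back of
the one below. Equality of the equations only near `p` suffices, which covers equations transported
by a local inverse of φ. -/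
theorem IsPullback.chartMeanCurvatureVanishes_iff {φ : M → N} {g : RiemMetric n N}
    {g' : RiemMetric n M} (hg : IsPullback φ g g') {p : M}
    (hφ : IsLocalDiffeomorphAt (𝓡 n) (𝓡 n) ∞ φ p) {f : N → ℝ} {f' : M → ℝ}
    (hf : ContMDiffAt (𝓡 n) 𝓘(ℝ, ℝ) ∞ f (φ p)) (hff' : f' =ᶠ[𝓝 p] f ∘ φ) :
    ChartMeanCurvatureVanishes (metricInChart g' p) (f' ∘ (extChartAt (𝓡 n) p).symm)
        (extChartAt (𝓡 n) p p) ↔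
      ChartMeanCurvatureVanishes (metricInChart g (φ p)) (f ∘ (extChartAt (𝓡 n) (φ p)).symm)
        (extChartAt (𝓡 n) (φ p) (φ p)) := by
  set ψ := extChartAt (𝓡 n) (φ p) ∘ φ ∘ (extChartAt (𝓡 n) p).symm with hψ
  have hψp : ψ (extChartAt (𝓡 n) p p) = extChartAt (𝓡 n) (φ p) (φ p) := by
    simp only [hψ, Function.comp_apply, extChartAt_to_inv]
  have hmetric : metricInChart g' p =ᶠ[𝓝 (extChartAt (𝓡 n) p p)]
      formPullback (metricInChart g (φ p)) ψ :=
    chartForm_pullback_eventuallyEq (hg.1 p) (Eventually.of_forall hg.2)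
  have hc : Tendsto (extChartAt (𝓡 n) p).symm (𝓝 (extChartAt (𝓡 n) p p)) (𝓝 p) := by
    have := continuousAt_extChartAt_symm (I := 𝓡 n) p
    rwa [ContinuousAt, extChartAt_to_inv] at this
  have hfun : f' ∘ (extChartAt (𝓡 n) p).symm =ᶠ[𝓝 (extChartAt (𝓡 n) p p)]
      (f ∘ (extChartAt (𝓡 n) (φ p)).symm) ∘ ψ := by
    have h2 : ∀ᶠ x in 𝓝 p, φ x ∈ (extChartAt (𝓡 n) (φ p)).source :=
      (hg.1 p).continuousAt.eventually (extChartAt_source_mem_nhds (I := 𝓡 n) (φ p))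
    filter_upwards [hc.eventually h2, hc.eventually hff'] with y hy1 hy2
    simp only [Function.comp_apply, hψ] at hy2 ⊢
    rw [(extChartAt (𝓡 n) (φ p)).left_inv hy1, hy2]
  have hF : ContDiffAt ℝ ∞ (f ∘ (extChartAt (𝓡 n) (φ p)).symm) (ψ (extChartAt (𝓡 n) p p)) := by
    rw [hψp]
    have h3 : ContMDiffAt 𝓘(ℝ, EuclideanSpace ℝ (Fin n)) (𝓡 n) ∞ (extChartAt (𝓡 n) (φ p)).symm
        (extChartAt (𝓡 n) (φ p) (φ p)) :=
      (contMDiffOn_extChartAt_symm _).contMDiffAt (extChartAt_target_mem_nhds _)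
    exact (ContMDiffAt.comp_of_eq hf h3 (extChartAt_to_inv (φ p))).contDiffAt
  have hmain := chartMeanCurvatureVanishes_formPullback_iff (G := metricInChart g (φ p))
    (F := f ∘ (extChartAt (𝓡 n) (φ p)).symm) (ψ := ψ) (y := extChartAt (𝓡 n) p p)
    (by rw [hψp]; exact g.contDiffAt_metricInChart _) (hg.1 p).contDiffAt_extChartAt hF
    (g.metricInChart_symm _ _)
    (by rw [hψp]; exact g.metricInChart_pos _ (mem_extChartAt_target _))
    hφ.isInvertible_fderiv_extChartAt
  rw [hψp] at hmain
  rw [← hmain]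
  exact ⟨fun h => h.congr hmetric.symm hfun.symm, fun h => h.congr hmetric hfun⟩

omit [IsManifold (𝓡 n) ∞ M] [IsManifold (𝓡 n) ∞ N] in
theorem IsLocalEquation.comp {φ : M → N} (hφ : IsLocalDiffeomorph (𝓡 n) (𝓡 n) ∞ φ)
    {S : Set N} {p : M} {U : Set N} {f : N → ℝ} (h : IsLocalEquation (n := n) S (φ p) U f) :
    IsLocalEquation (n := n) (φ ⁻¹' S) p (φ ⁻¹' U) (f ∘ φ) where
  isOpen := h.isOpen.preimage hφ.contMDiff.continuous
  mem := h.mem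
  smooth := h.smooth.comp hφ.contMDiff.contMDiffOn (fun _ hx => hx)
  zero_iff q hq := h.zero_iff _ hq
  regular q hq hqS := by
    have hf : MDifferentiableAt (𝓡 n) 𝓘(ℝ, ℝ) f (φ q) :=
      (h.smooth.contMDiffAt (h.isOpen.mem_nhds hq)).mdifferentiableAt (by simp)
    rw [mfderiv_comp q hf ((hφ q).mdifferentiableAt (by simp))]
    intro h0
    refine h.regular _ hq hqS ?_
    ext u
    obtain ⟨v, rfl⟩ := ((hφ q).mfderivToContinuousLinearEquiv (by simp)).surjective u
    exact DFunLike.congr_fun h0 v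

omit [IsManifold (𝓡 n) ∞ M] [IsManifold (𝓡 n) ∞ N] in
-- A local equation of the preimage need not be a composition with φ, so it is carried to the target
-- by a local inverse. Minimality quantifies over all local equations, hence transport is needed in
-- both directions.
theorem IsLocalEquation.comp_symm {φ : M → N}
    {S : Set N} {p : M} {U : Set M} {f : M → ℝ}
    (h : IsLocalEquation (n := n) (φ ⁻¹' S) p U f)
    (Φ : PartialDiffeomorph (𝓡 n) (𝓡 n) M N ∞) (hp : p ∈ Φ.source) (hΦ : EqOn φ Φ Φ.source) :
    IsLocalEquation (n := n) S (φ p) (Φ.target ∩ Φ.symm ⁻¹' U) (f ∘ Φ.symm) := by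
  have hsymm : ∀ q ∈ Φ.target, φ (Φ.symm q) = q := fun q hq => by
    exact (hΦ (Φ.map_target hq)).trans (Φ.right_inv hq)
  have hop : IsOpen (Φ.target ∩ Φ.symm ⁻¹' U) :=
    Φ.toOpenPartialHomeomorph.symm.isOpen_inter_preimage h.isOpen
  have hsm : ContMDiffOn (𝓡 n) (𝓡 n) ∞ Φ.symm Φ.target := Φ.symm.contMDiffOn
  refine ⟨hop, ?_, ?_, ?_, ?_⟩
  · rw [hΦ hp]
    refine ⟨Φ.map_source hp, ?_⟩
    change Φ.symm (Φ p) ∈ U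
    have : Φ.symm (Φ p) = p := Φ.left_inv hp
    rw [this]
    exact h.mem
  · exact h.smooth.comp (hsm.mono inter_subset_left) (fun _ hx => hx.2)
  · rintro q ⟨hq1, hq2⟩
    rw [Function.comp_apply, ← h.zero_iff _ hq2, mem_preimage, hsymm q hq1]
  · rintro q ⟨hq1, hq2⟩ hqS
    have hloc := PartialDiffeomorph.isLocalDiffeomorphAt _ _ _ Φ.symm (x := q) hq1
    have hf : MDifferentiableAt (𝓡 n) 𝓘(ℝ, ℝ) f (Φ.symm q) :=
      (h.smooth.contMDiffAt (h.isOpen.mem_nhds hq2)).mdifferentiableAt (by simp)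
    rw [mfderiv_comp q hf (hloc.mdifferentiableAt (by simp))]
    intro h0
    refine h.regular _ hq2 (by rwa [mem_preimage, hsymm q hq1]) ?_
    ext u
    obtain ⟨v, rfl⟩ := (hloc.mfderivToContinuousLinearEquiv (by simp)).surjective u
    exact DFunLike.congr_fun h0 v

omit [IsManifold (𝓡 n) ∞ M] [IsManifold (𝓡 n) ∞ N] in
theorem PartialDiffeomorph.comp_symm_comp_eventuallyEq {φ : M → N} {p : M} (f : M → ℝ)
    (Φ : PartialDiffeomorph (𝓡 n) (𝓡 n) M N ∞) (hp : p ∈ Φ.source) (hΦ : EqOn φ Φ Φ.source) :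
    f =ᶠ[𝓝 p] (f ∘ Φ.symm) ∘ φ := by
  filter_upwards [Φ.open_source.mem_nhds hp] with x hx
  have : Φ.symm (Φ x) = x := Φ.left_inv hx
  simp only [Function.comp_apply]
  rw [hΦ hx, this]

/-- The preimage of a minimal hypersurface under a local isometry is minimal. -/
theorem IsMinimalHypersurface.preimage {φ : M → N} {g : RiemMetric n N}
    {g' : RiemMetric n M} (hg : IsPullback φ g g')
    (hφ : IsLocalDiffeomorph (𝓡 n) (𝓡 n) ∞ φ) {S : Set N} (h : IsMinimalHypersurface g S) :
    IsMinimalHypersurface g' (φ ⁻¹' S) := by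
  intro p hp
  obtain ⟨⟨U, f, hf⟩, h2⟩ := h (φ p) hp
  refine ⟨⟨_, _, hf.comp hφ⟩, fun U' f' hf' => ?_⟩
  obtain ⟨Φ, hpΦ, hΦ⟩ := hφ p
  have heq := hf'.comp_symm Φ hpΦ hΦ
  exact (hg.chartMeanCurvatureVanishes_iff (hφ p)
    (heq.smooth.contMDiffAt (heq.isOpen.mem_nhds heq.mem))
    (Φ.comp_symm_comp_eventuallyEq f' hpΦ hΦ)).2 (h2 _ _ heq)

/-- A set whose preimage under a surjective local isometry is a minimal hypersurface is minimal. -/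
theorem IsMinimalHypersurface.of_preimage {φ : M → N} {g : RiemMetric n N}
    {g' : RiemMetric n M} (hg : IsPullback φ g g')
    (hφ : IsLocalDiffeomorph (𝓡 n) (𝓡 n) ∞ φ) (hsurj : Function.Surjective φ) {S : Set N}
    (h : IsMinimalHypersurface g' (φ ⁻¹' S)) : IsMinimalHypersurface g S := by
  intro q hq
  obtain ⟨p, rfl⟩ := hsurj q
  obtain ⟨⟨U, f, hf⟩, h2⟩ := h p hq
  obtain ⟨Φ, hpΦ, hΦ⟩ := hφ p
  refine ⟨⟨_, _, hf.comp_symm Φ hpΦ hΦ⟩, fun U' f' hf' => ?_⟩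
  exact (hg.chartMeanCurvatureVanishes_iff (hφ p)
    (hf'.smooth.contMDiffAt (hf'.isOpen.mem_nhds hf'.mem)) EventuallyEq.rfl).1
    (h2 _ _ (hf'.comp hφ))

end MinimalNaturality

end

noncomputable section

open Filter Topology Bundle

/-! ### Trace identities and derivatives of Gram determinants -/

section LinearAlgebra

/-- The trace of a bilinear form does not depend on the orthonormal basis. -/
theorem OrthonormalBasis.sum_bilin_eq {ι κ V : Type*} [Fintype ι] [Fintype κ]
    [NormedAddCommGroup V] [InnerProductSpace ℝ V] [FiniteDimensional ℝ V]
    (b : OrthonormalBasis ι ℝ V) (c : OrthonormalBasis κ ℝ V) (B : V →L[ℝ] V →L[ℝ] ℝ) :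
    ∑ i, B (b i) (b i) = ∑ i, B (c i) (c i) := by
  have key : ∀ v w, ⟪w, InnerProductSpace.continuousLinearMapOfBilin (𝕜 := ℝ) B v⟫ = B v w := by
    intro v w
    rw [real_inner_comm]
    exact InnerProductSpace.continuousLinearMapOfBilin_apply B v w
  have h1 := LinearMap.trace_eq_sum_inner
    (InnerProductSpace.continuousLinearMapOfBilin (𝕜 := ℝ) B : V →ₗ[ℝ] V) b
  have h2 := LinearMap.trace_eq_sum_inner
    (InnerProductSpace.continuousLinearMapOfBilin (𝕜 := ℝ) B : V →ₗ[ℝ] V) c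
  rw [h1] at h2
  simpa [key] using h2

/-- A positive definite symmetric bilinear form has an orthonormal basis. -/
theorem exists_basis_orthonormal {V : Type*} [AddCommGroup V] [Module ℝ V]
    [FiniteDimensional ℝ V] (n : ℕ) (hn : Module.finrank ℝ V = n) (B : V →ₗ[ℝ] V →ₗ[ℝ] ℝ)
    (hsymm : ∀ u v, B u v = B v u) (hpos : ∀ v, v ≠ 0 → 0 < B v v) :
    ∃ c : Module.Basis (Fin n) ℝ V, ∀ i j, B (c i) (c j) = if i = j then 1 else 0 := by
  -- `V` carries no norm in the statement, so `B` itself can serve as its inner product.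
  let core : InnerProductSpace.Core ℝ V :=
    { inner := fun v w => B v w
      conj_inner_symm := fun v w => hsymm w v
      re_inner_nonneg := fun v => by
        rcases eq_or_ne v 0 with rfl | hv
        · simp
        · exact (hpos v hv).le
      add_left := fun v w x => by simp
      smul_left := fun v w r => by simp
      definite := fun v h => by
        by_contra hv
        exact (hpos v hv).ne' h }
  let _ : NormedAddCommGroup V := core.toNormedAddCommGroup
  let _ : InnerProductSpace ℝ V := InnerProductSpace.ofCore core.toCore
  let c := (stdOrthonormalBasis ℝ V).reindex (finCongr hn)
  refine ⟨c.toBasis, fun i j => ?_⟩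
  have := orthonormal_iff_ite.1 c.orthonormal i j
  rw [← this]
  simp only [OrthonormalBasis.coe_toBasis]
  rfl

/-- The algebraic consequence of the vanishing of the mean curvature of all hyperplanes. -/
theorem cubic_eq_trace_of_euclidean {n : ℕ} (hn : 1 ≤ n)
    (T : EuclideanSpace ℝ (Fin n) →ₗ[ℝ] EuclideanSpace ℝ (Fin n) →L[ℝ]
      EuclideanSpace ℝ (Fin n) →L[ℝ] ℝ)
    (hsymm : ∀ u v w, T u v w = T u w v)
    (H : ∀ (e : Fin (n - 1) → EuclideanSpace ℝ (Fin n)) (ν : EuclideanSpace ℝ (Fin n)),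
      (∀ i j, ⟪e i, e j⟫ = if i = j then (1 : ℝ) else 0) → (∀ i, ⟪ν, e i⟫ = 0) → ⟪ν, ν⟫ = 1 →
      ∑ i, (2 * T (e i) (e i) ν - T ν (e i) (e i)) = 0)
    (v : EuclideanSpace ℝ (Fin n)) :
    (n + 1) * T v v v = 2 * ⟪v, v⟫ *
      ∑ i, T v (EuclideanSpace.basisFun (Fin n) ℝ i) (EuclideanSpace.basisFun (Fin n) ℝ i) := by
  set b := EuclideanSpace.basisFun (Fin n) ℝ with hb
  have hbb : ∀ i, ⟪b i, b i⟫ = 1 := fun i => by simp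
  obtain ⟨k, rfl⟩ : ∃ k, n = k + 1 := ⟨n - 1, by omega⟩
  -- The expression in `H`, but summed over a full orthonormal basis. For a unit `ν` it exceeds the
  -- hyperplane sum by 2T(ν,ν,ν) - T(ν,ν,ν), so `H` says T(ν,ν,ν) = ℓ(ν).
  set ℓ : EuclideanSpace ℝ (Fin (k + 1)) → ℝ :=
    fun w => ∑ i, (2 * T (b i) (b i) w - T w (b i) (b i)) with hℓ
  have hℓadd : ∀ u w, ℓ (u + w) = ℓ u + ℓ w := fun u w => by
    simp only [hℓ, map_add, add_apply, ← Finset.sum_add_distrib]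
    exact Finset.sum_congr rfl fun i _ => by ring
  have hℓsmul : ∀ (r : ℝ) u, ℓ (r • u) = r * ℓ u := fun r u => by
    simp only [hℓ, map_smul, smul_apply, smul_eq_mul, Finset.mul_sum]
    exact Finset.sum_congr rfl fun i _ => by ring
  have hunit : ∀ ν, ⟪ν, ν⟫ = 1 → T ν ν ν = ℓ ν := by
    intro ν hν
    have hν1 : ‖ν‖ = 1 := by
      rw [real_inner_self_eq_norm_sq] at hν
      nlinarith [norm_nonneg ν]
    have hon : Orthonormal ℝ (({0} : Set (Fin (k + 1))).domRestrict (fun _ => ν)) := by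
      refine ⟨fun i => hν1, fun i j hij => absurd (Subsingleton.elim i j) hij⟩
    -- `ν` becomes the vector of index 0, and the remaining `c i.succ` span the hyperplane to which
    -- `H` applies.
    obtain ⟨c, hc⟩ := hon.exists_orthonormalBasis_extension_of_card_eq (by simp)
    have hc0 : c 0 = ν := hc 0 (by simp)
    have hcon := orthonormal_iff_ite.1 c.orthonormal
    have hH := H (fun i => c (Fin.succ i)) ν (fun i j => by rw [hcon]; simp)
      (fun i => by rw [← hc0, hcon]; simp [(Fin.succ_ne_zero i).symm]) hν
    let B : EuclideanSpace ℝ (Fin (k + 1)) →L[ℝ] EuclideanSpace ℝ (Fin (k + 1)) →L[ℝ] ℝ :=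
      LinearMap.toContinuousLinearMap
        { toFun := fun u => (T u).flip ν
          map_add' := fun u w => by ext; simp
          map_smul' := fun r u => by ext; simp }
    have h1 := b.sum_bilin_eq c (T ν)
    have h2 := b.sum_bilin_eq c B
    have hB : ∀ u w, B u w = T u w ν := fun u w => rfl
    simp only [hB] at h2
    have h3 : ℓ ν = ∑ i, (2 * T (c i) (c i) ν - T ν (c i) (c i)) := by
      simp only [hℓ, Finset.sum_sub_distrib, ← Finset.mul_sum]
      rw [h1, h2]
    rw [Fin.sum_univ_succ] at h3
    simp only [hc0] at h3
    have hH' : ∑ i : Fin k, (2 * T (c i.succ) (c i.succ) ν - T ν (c i.succ) (c i.succ)) = 0 := hH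
    rw [hH'] at h3
    linarith
  have hall : ∀ w, T w w w = ⟪w, w⟫ * ℓ w := by
    intro w
    rcases eq_or_ne w 0 with rfl | hw
    · simp
    · have hw' : ‖w‖ ≠ 0 := by simpa using hw
      have h := hunit (‖w‖⁻¹ • w) (by
        rw [real_inner_smul_left, real_inner_smul_right, real_inner_self_eq_norm_sq]
        field_simp)
      simp only [map_smul, smul_apply, smul_eq_mul, hℓsmul] at h
      rw [real_inner_self_eq_norm_sq]
      field_simp at h
      linarith
  -- Polarisation: the values of `hall` at v + bᵢ and v - bᵢ are added, and twice its value at v is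
  -- subtracted.
  have hpol : ∀ i, T v (b i) (b i) + 2 * T (b i) (b i) v = ℓ v + 2 * ⟪v, b i⟫ * ℓ (b i) := by
    intro i
    have h1 := hall (v + b i)
    have h2 := hall (v + (-1 : ℝ) • b i)
    have h3 := hall v
    have h4 := hall (b i)
    simp only [map_add, add_apply, hℓadd, hℓsmul, map_smul, smul_apply, smul_eq_mul,
      inner_add_left, inner_add_right, real_inner_smul_left, real_inner_smul_right] at h1 h2
    rw [hbb] at h1 h2 h4
    rw [real_inner_comm v (b i)] at h1 h2
    rw [hsymm (b i) v (b i)] at h1 h2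
    rw [hsymm v (b i) v] at h1 h2
    linarith
  have hsum := Finset.sum_congr (s₁ := Finset.univ) rfl fun i _ => hpol i
  have hlin : ∑ i, ⟪v, b i⟫ * ℓ (b i) = ℓ v := by
    conv_rhs => rw [← b.sum_repr' v]
    have : ∀ s : Finset (Fin (k + 1)), ℓ (∑ i ∈ s, ⟪b i, v⟫ • b i) = ∑ i ∈ s, ⟪v, b i⟫ * ℓ (b i) := by
      intro s
      induction s using Finset.induction_on with
      | empty => simpa using hℓsmul 0 0
      | insert a s ha ih =>
        rw [Finset.sum_insert ha, Finset.sum_insert ha, hℓadd, hℓsmul, ih, real_inner_comm]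
    exact (this _).symm
  have hlv : ℓ v = 2 * ∑ i, T (b i) (b i) v - ∑ i, T v (b i) (b i) := by
    simp only [hℓ, Finset.sum_sub_distrib, ← Finset.mul_sum]
  simp only [Finset.sum_add_distrib, ← Finset.mul_sum, mul_assoc, hlin, Finset.sum_const,
    Finset.card_univ, Fintype.card_fin, nsmul_eq_mul] at hsum
  -- Summing `hpol` over i gives (n+2) ℓ(v) on the right, with n = k + 1. By the definition of ℓ,
  -- the left side is ℓ(v) plus twice the trace of T(v, ·, ·).
  have hfin : ((k : ℝ) + 1 + 1) * ℓ v = 2 * ∑ i, T v (b i) (b i) := by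
    push_cast at hsum
    linarith
  rw [hall v]
  push_cast
  linear_combination ⟪v, v⟫ * hfin

/-- The linear map taking the standard basis to the `B`-orthonormal basis `c` carries the Euclidean
inner product to `B` and reduces to the Euclidean case. -/
theorem cubic_eq_trace {n : ℕ} (hn : 1 ≤ n)
    (B : EuclideanSpace ℝ (Fin n) →L[ℝ] EuclideanSpace ℝ (Fin n) →L[ℝ] ℝ)
    (T : EuclideanSpace ℝ (Fin n) →ₗ[ℝ] EuclideanSpace ℝ (Fin n) →L[ℝ]
      EuclideanSpace ℝ (Fin n) →L[ℝ] ℝ)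
    (hsymm : ∀ u v w, T u v w = T u w v)
    (H : ∀ (e : Fin (n - 1) → EuclideanSpace ℝ (Fin n)) (ν : EuclideanSpace ℝ (Fin n)),
      (∀ i j, B (e i) (e j) = if i = j then (1 : ℝ) else 0) → (∀ i, B ν (e i) = 0) → B ν ν = 1 →
      ∑ i, (2 * T (e i) (e i) ν - T ν (e i) (e i)) = 0)
    (c : Module.Basis (Fin n) ℝ (EuclideanSpace ℝ (Fin n)))
    (hc : ∀ i j, B (c i) (c j) = if i = j then (1 : ℝ) else 0)
    (v : EuclideanSpace ℝ (Fin n)) :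
    (n + 1) * T v v v = 2 * B v v * ∑ i, T v (c i) (c i) := by
  let b := EuclideanSpace.basisFun (Fin n) ℝ
  let A : EuclideanSpace ℝ (Fin n) ≃L[ℝ] EuclideanSpace ℝ (Fin n) :=
    (b.toBasis.equiv c (Equiv.refl _)).toContinuousLinearEquiv
  have hA : ∀ i, A (b i) = c i := fun i => by
    have := b.toBasis.equiv_apply i c (Equiv.refl _)
    simpa [A] using this
  have hAB : ∀ u w, B (A u) (A w) = ⟪u, w⟫ := by
    intro u w
    rw [← b.sum_inner_mul_inner, ← b.sum_repr' u, ← b.sum_repr' w]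
    simp only [map_sum, map_smul, hA, sum_apply, smul_apply, hc, smul_eq_mul, mul_ite,
      mul_one, mul_zero, Finset.sum_ite_eq', Finset.mem_univ, if_true]
    rw [b.sum_repr' u, b.sum_repr' w]
    exact Finset.sum_congr rfl fun i _ => by rw [real_inner_comm u]; ring
  let T' : EuclideanSpace ℝ (Fin n) →ₗ[ℝ] EuclideanSpace ℝ (Fin n) →L[ℝ]
      EuclideanSpace ℝ (Fin n) →L[ℝ] ℝ :=
    { toFun := fun u => (T (A u)).bilinearComp (A : _ →L[ℝ] _) (A : _ →L[ℝ] _)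
      map_add' := fun u w => by ext; simp
      map_smul' := fun r u => by ext; simp }
  have hT' : ∀ u v w, T' u v w = T (A u) (A v) (A w) := fun u v w => rfl
  have h := cubic_eq_trace_of_euclidean hn T' (fun u v w => by simp only [hT', hsymm])
    (fun e ν h1 h2 h3 => by
      simp only [hT']
      exact H (fun i => A (e i)) (A ν) (fun i j => by rw [hAB, h1]) (fun i => by rw [hAB, h2])
        (by rw [hAB, h3])) (A.symm v)
  rw [← hAB] at h
  simp only [hT', ContinuousLinearEquiv.apply_symm_apply] at h
  rw [h]
  congr 1
  exact Finset.sum_congr rfl fun i _ => by rw [← hA i]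

/-- Jacobi's formula at the identity matrix. A permutation other than 1 moves at least two indices,
so after one factor is differentiated an off-diagonal entry of the identity is still left in the
product. -/
theorem hasDerivAt_det_of_eq_one {m : ℕ} {M : ℝ → Matrix (Fin m) (Fin m) ℝ}
    {M' : Matrix (Fin m) (Fin m) ℝ} {t : ℝ} (hM : ∀ i j, HasDerivAt (fun s => M s i j) (M' i j) t)
    (h1 : M t = 1) : HasDerivAt (fun s => (M s).det) (∑ i, M' i i) t := by
  simp only [Matrix.det_apply]
  have h := HasDerivAt.fun_sum (u := Finset.univ) fun (σ : Equiv.Perm (Fin m)) _ =>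
    (HasDerivAt.fun_finsetProd (u := Finset.univ) fun i _ => hM (σ i) i).const_smul
      (Equiv.Perm.sign σ)
  refine h.congr_deriv ?_
  rw [Finset.sum_eq_single 1]
  · simp [h1]
  · intro σ _ hσ
    rw [Finset.sum_eq_zero, smul_zero]
    intro i _
    have : ∃ j, j ≠ i ∧ σ j ≠ j := by
      by_contra! hcon
      apply hσ
      have hi : σ i = i := by
        by_contra hne
        have h2 := hcon (σ i) hne
        exact hne (σ.injective h2)
      ext j
      by_cases hj : j = i
      · simp [hj, hi]
      · simp [hcon j hj]
    obtain ⟨j, hji, hj⟩ := this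
    rw [Finset.prod_eq_zero (i := j) (by simp [hji]) (by simp [h1, Matrix.one_apply_ne hj]),
      zero_smul]
  · simp

/-- The Gram matrix of a bilinear form in a family of vectors. -/
def gram {m : ℕ} (B : EuclideanSpace ℝ (Fin m) →L[ℝ] EuclideanSpace ℝ (Fin m) →L[ℝ] ℝ)
    (c : Fin m → EuclideanSpace ℝ (Fin m)) : Matrix (Fin m) (Fin m) ℝ :=
  Matrix.of fun i j => B (c i) (c j)

theorem gram_eq {m : ℕ} (B : EuclideanSpace ℝ (Fin m) →L[ℝ] EuclideanSpace ℝ (Fin m) →L[ℝ] ℝ)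
    (c : Fin m → EuclideanSpace ℝ (Fin m)) :
    gram B c = Matrix.of (fun i j => c i j) * gram B (EuclideanSpace.basisFun (Fin m) ℝ) *
      (Matrix.of (fun i j => c i j)).transpose := by
  ext i j
  have hrepr : ∀ w : EuclideanSpace ℝ (Fin m),
      w = ∑ a, w a • EuclideanSpace.basisFun (Fin m) ℝ a := fun w => by
    conv_lhs => rw [← (EuclideanSpace.basisFun (Fin m) ℝ).sum_repr w]
    simp
  simp only [gram, Matrix.of_apply, Matrix.mul_apply, Matrix.transpose_apply]
  conv_lhs => rw [hrepr (c i), hrepr (c j)]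
  simp only [map_sum, map_smul, sum_apply, smul_apply, smul_eq_mul, Finset.sum_mul,
    Finset.mul_sum]
  exact Finset.sum_congr rfl fun a _ => Finset.sum_congr rfl fun b _ => by ring

theorem det_gram_eq {m : ℕ}
    (B : EuclideanSpace ℝ (Fin m) →L[ℝ] EuclideanSpace ℝ (Fin m) →L[ℝ] ℝ)
    (c : Fin m → EuclideanSpace ℝ (Fin m)) :
    (gram B c).det = (Matrix.of (fun i j => c i j)).det ^ 2 *
      (gram B (EuclideanSpace.basisFun (Fin m) ℝ)).det := by
  rw [gram_eq, Matrix.det_mul, Matrix.det_mul, Matrix.det_transpose]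
  ring

/-- Jacobi's formula, with the trace taken in an orthonormal frame. With `c` frozen, the Gram
determinants in `c` and in the standard basis differ by the constant factor k², and in `c` the Gram
matrix at time t is the identity. -/
theorem hasDerivAt_det_gram {m : ℕ}
    {B : ℝ → EuclideanSpace ℝ (Fin m) →L[ℝ] EuclideanSpace ℝ (Fin m) →L[ℝ] ℝ}
    {B' : EuclideanSpace ℝ (Fin m) →L[ℝ] EuclideanSpace ℝ (Fin m) →L[ℝ] ℝ} {t : ℝ}
    (hB : HasDerivAt B B' t) (c : Fin m → EuclideanSpace ℝ (Fin m)) (hc : gram (B t) c = 1) :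
    HasDerivAt (fun s => (gram (B s) (EuclideanSpace.basisFun (Fin m) ℝ)).det)
      ((gram (B t) (EuclideanSpace.basisFun (Fin m) ℝ)).det * ∑ i, B' (c i) (c i)) t := by
  set k := (Matrix.of (fun i j => c i j)).det with hk
  have h1 : k ^ 2 * (gram (B t) (EuclideanSpace.basisFun (Fin m) ℝ)).det = 1 := by
    rw [← det_gram_eq, hc, Matrix.det_one]
  have hk0 : k ^ 2 ≠ 0 := left_ne_zero_of_mul_eq_one h1
  have h2 : HasDerivAt (fun s => (gram (B s) c).det) (∑ i, B' (c i) (c i)) t :=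
    hasDerivAt_det_of_eq_one (M := fun s => gram (B s) c) (M' := gram B' c)
      (fun i j => by
        have := (hB.clm_apply (hasDerivAt_const t (c i))).clm_apply (hasDerivAt_const t (c j))
        simpa [gram] using this) hc
  have h3 := h2.const_mul (k ^ 2)⁻¹
  have h4 : (fun s => (gram (B s) (EuclideanSpace.basisFun (Fin m) ℝ)).det) =
      fun s => (k ^ 2)⁻¹ * (gram (B s) c).det := by
    funext s
    rw [det_gram_eq _ c, ← hk, ← mul_assoc, inv_mul_cancel₀ hk0, one_mul]
  rw [h4]
  refine h3.congr_deriv ?_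
  rw [eq_inv_of_mul_eq_one_right h1]

end LinearAlgebra

end

noncomputable section

open Filter Topology Bundle Metric

/-! ### Stereographic charts of the sphere -/

section SphereCharts

variable {n : ℕ}

theorem fact_finrank_euclideanSpace_succ (n : ℕ) :
    Fact (Module.finrank ℝ (EuclideanSpace ℝ (Fin (n + 1))) = n + 1) :=
  ⟨finrank_euclideanSpace_fin⟩

theorem contMDiff_coe_sph : ContMDiff (𝓡 n) (𝓡 (n + 1)) ∞
    ((↑) : Sph n → EuclideanSpace ℝ (Fin (n + 1))) :=
  have := fact_finrank_euclideanSpace_succ n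
  contMDiff_coe_sphere

/-- The inverse of the preferred chart of the sphere at `p`, as a map to the ambient space. -/
def chartParam (p : Sph n) (y : EuclideanSpace ℝ (Fin n)) : EuclideanSpace ℝ (Fin (n + 1)) :=
  ((extChartAt (𝓡 n) p).symm y : Sph n)

/-- The identification of `ℝⁿ` with the hyperplane `p^⊥` that comes with the preferred chart. -/
def tangentIncl (p : Sph n) : EuclideanSpace ℝ (Fin n) →ₗᵢ[ℝ] EuclideanSpace ℝ (Fin (n + 1)) :=
  have := fact_finrank_euclideanSpace_succ n
  ((ℝ ∙ ((-p : Sph n) : EuclideanSpace ℝ (Fin (n + 1))))ᗮ.subtypeₗᵢ).comp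
    (OrthonormalBasis.fromOrthogonalSpanSingleton (𝕜 := ℝ) n
      (ne_zero_of_mem_unit_sphere (-p))).repr.symm.toLinearIsometry

/-- The preferred chart at `p` is the stereographic projection from `-p`, so it is centred at `p`.
-/
theorem chartParam_eq (p : Sph n) (y : EuclideanSpace ℝ (Fin n)) :
    chartParam p y = stereoInvFunAux (-p : EuclideanSpace ℝ (Fin (n + 1))) (tangentIncl p y) := rfl

theorem inner_tangentIncl (p : Sph n) (w : EuclideanSpace ℝ (Fin n)) :
    ⟪tangentIncl p w, (p : EuclideanSpace ℝ (Fin (n + 1)))⟫ = 0 := by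
  have := fact_finrank_euclideanSpace_succ n
  have h := Submodule.mem_orthogonal_singleton_iff_inner_left.1
    ((OrthonormalBasis.fromOrthogonalSpanSingleton (𝕜 := ℝ) n
      (ne_zero_of_mem_unit_sphere (-p))).repr.symm w).2
  change ⟪tangentIncl p w, ((-p : Sph n) : EuclideanSpace ℝ (Fin (n + 1)))⟫ = 0 at h
  rwa [coe_neg_sphere, inner_neg_right, neg_eq_zero] at h

theorem exists_tangentIncl_eq (p : Sph n) {v : EuclideanSpace ℝ (Fin (n + 1))}
    (hv : ⟪v, (p : EuclideanSpace ℝ (Fin (n + 1)))⟫ = 0) : ∃ w, tangentIncl p w = v := by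
  have := fact_finrank_euclideanSpace_succ n
  have hv' : v ∈ (ℝ ∙ ((-p : Sph n) : EuclideanSpace ℝ (Fin (n + 1))))ᗮ := by
    rw [Submodule.mem_orthogonal_singleton_iff_inner_left, coe_neg_sphere, inner_neg_right, hv,
      neg_zero]
  refine ⟨(OrthonormalBasis.fromOrthogonalSpanSingleton (𝕜 := ℝ) n
      (ne_zero_of_mem_unit_sphere (-p))).repr ⟨v, hv'⟩, ?_⟩
  change (((OrthonormalBasis.fromOrthogonalSpanSingleton (𝕜 := ℝ) n
      (ne_zero_of_mem_unit_sphere (-p))).repr.symm ((OrthonormalBasis.fromOrthogonalSpanSingleton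
      (𝕜 := ℝ) n (ne_zero_of_mem_unit_sphere (-p))).repr ⟨v, hv'⟩) :
      (ℝ ∙ ((-p : Sph n) : EuclideanSpace ℝ (Fin (n + 1))))ᗮ) : EuclideanSpace ℝ (Fin (n + 1))) = v
  rw [LinearIsometryEquiv.symm_apply_apply]

theorem extChartAt_sph_target (p : Sph n) : (extChartAt (𝓡 n) p).target = univ := by
  have := fact_finrank_euclideanSpace_succ n
  have h : (stereographic' n (-p)).target = univ := stereographic'_target _
  simp only [extChartAt, OpenPartialHomeomorph.extend_target, modelWithCornersSelf_coe_symm,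
    modelWithCornersSelf_coe, Set.range_id, Set.inter_univ, Set.preimage_id]
  exact h

theorem chartParam_zero (p : Sph n) : chartParam p 0 = p := by
  rw [chartParam_eq]
  simp only [map_zero, stereoInvFunAux_apply, norm_zero]
  rw [smul_zero, zero_add, smul_smul, smul_neg, ← neg_smul]
  norm_num

theorem extChartAt_sph_self (p : Sph n) : extChartAt (𝓡 n) p p = 0 := by
  have h : (extChartAt (𝓡 n) p).symm 0 = p := Subtype.ext (chartParam_zero p)
  conv_lhs => rw [← h]
  rw [h]
  conv_lhs => arg 2; rw [← h]
  exact (extChartAt (𝓡 n) p).right_inv (by rw [extChartAt_sph_target]; trivial)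

theorem hasFDerivAt_chartParam (p : Sph n) :
    HasFDerivAt (chartParam p) (tangentIncl p).toContinuousLinearMap 0 := by
  have h1 : HasFDerivAt (stereoInvFunAux (-p : EuclideanSpace ℝ (Fin (n + 1))))
      (ContinuousLinearMap.id ℝ _) ((tangentIncl p).toContinuousLinearMap 0) := by
    rw [map_zero]
    exact hasFDerivAt_stereoInvFunAux _
  exact h1.comp 0 (tangentIncl p).toContinuousLinearMap.hasFDerivAt

theorem contDiff_chartParam (p : Sph n) : ContDiff ℝ ∞ (chartParam p) :=
  contDiff_stereoInvFunAux.comp (tangentIncl p).contDiff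

theorem norm_chartParam (p : Sph n) (y : EuclideanSpace ℝ (Fin n)) : ‖chartParam p y‖ = 1 := by
  simp [chartParam]

/-- Inverse stereographic projection has an odd component along the hyperplane p^⊥ and an even one
along p; `v` sees only the odd one. This kills the second derivative of the equation of an equator
through `p`. -/
theorem inner_chartParam_neg (p : Sph n) {v : EuclideanSpace ℝ (Fin (n + 1))}
    (hv : ⟪(p : EuclideanSpace ℝ (Fin (n + 1))), v⟫ = 0) (y : EuclideanSpace ℝ (Fin n)) :
    ⟪chartParam p (-y), v⟫ = -⟪chartParam p y, v⟫ := by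
  simp only [chartParam_eq, stereoInvFunAux_apply, map_neg, norm_neg, real_inner_smul_left,
    inner_add_left, inner_neg_left, hv]
  ring

/-- The second derivative of an odd function vanishes at the origin. -/
theorem fderiv_fderiv_zero_of_odd {E : Type*} [NormedAddCommGroup E] [NormedSpace ℝ E] {f : E → ℝ}
    (hf : ContDiff ℝ ∞ f) (hodd : ∀ y, f (-y) = -f y) : fderiv ℝ (fderiv ℝ f) 0 = 0 := by
  have heven : ∀ y, fderiv ℝ f (-y) = fderiv ℝ f y := by
    intro y
    have h1 : HasFDerivAt (fun y => f (-y)) (fderiv ℝ f (-y) ∘L (-ContinuousLinearMap.id ℝ E)) y :=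
      (hf.differentiable (by simp) (-y)).hasFDerivAt.comp y (hasFDerivAt_id y).neg
    simp only [hodd] at h1
    have h2 := h1.unique (hf.differentiable (by simp) y).hasFDerivAt.neg
    ext u
    simpa using DFunLike.congr_fun h2 u
  have hd := ((hf.fderiv_right (m := ∞) (by simp)).differentiable (by simp) (0 : E)).hasFDerivAt
  have h3 : HasFDerivAt (fun y => fderiv ℝ f (-y))
      (fderiv ℝ (fderiv ℝ f) 0 ∘L (-ContinuousLinearMap.id ℝ E)) 0 :=
    HasFDerivAt.comp (g := fderiv ℝ f) 0 (by simpa using hd) (hasFDerivAt_id 0).neg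
  simp only [heven] at h3
  have h4 := h3.unique hd
  ext u w
  have h5 := DFunLike.congr_fun (DFunLike.congr_fun h4 u) w
  simp at h5 ⊢
  linarith

theorem fderiv_inner_chartParam (p : Sph n) (v : EuclideanSpace ℝ (Fin (n + 1)))
    (w : EuclideanSpace ℝ (Fin n)) :
    fderiv ℝ (fun y => ⟪chartParam p y, v⟫) 0 w = ⟪tangentIncl p w, v⟫ := by
  have := ((hasFDerivAt_chartParam p).inner ℝ (hasFDerivAt_const v 0)).fderiv
  rw [this]
  simp

theorem contDiff_inner_chartParam (p : Sph n) (v : EuclideanSpace ℝ (Fin (n + 1))) :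
    ContDiff ℝ ∞ (fun y => ⟪chartParam p y, v⟫) :=
  (contDiff_chartParam p).inner ℝ contDiff_const

/-- By oddness, the second derivative of the parametrization at its centre is radial. -/
theorem fderiv_fderiv_chartParam (p : Sph n) {v : EuclideanSpace ℝ (Fin (n + 1))}
    (hv : ⟪(p : EuclideanSpace ℝ (Fin (n + 1))), v⟫ = 0) (u w : EuclideanSpace ℝ (Fin n)) :
    ⟪fderiv ℝ (fderiv ℝ (chartParam p)) 0 u w, v⟫ = 0 := by
  have h0 := fderiv_fderiv_zero_of_odd (contDiff_inner_chartParam p v) (inner_chartParam_neg p hv)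
  have h1 : ∀ y, fderiv ℝ (fun y => ⟪chartParam p y, v⟫) y = (innerSL ℝ v) ∘L
      fderiv ℝ (chartParam p) y := by
    intro y
    have h2 : HasFDerivAt (chartParam p) (fderiv ℝ (chartParam p) y) y :=
      ((contDiff_chartParam p).differentiable (by simp) y).hasFDerivAt
    have h3 := (h2.inner ℝ (hasFDerivAt_const v y)).fderiv
    rw [h3]
    ext z
    simp [real_inner_comm]
  have h2 : HasFDerivAt (fderiv ℝ (chartParam p)) (fderiv ℝ (fderiv ℝ (chartParam p)) 0) 0 :=
    (((contDiff_chartParam p).fderiv_right (m := ∞) (by simp)).differentiable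
      (by simp) 0).hasFDerivAt
  have h3 := (hasFDerivAt_const (innerSL ℝ v) (0 : EuclideanSpace ℝ (Fin n))).clm_comp h2
  have h4 : fderiv ℝ (fun y => ⟪chartParam p y, v⟫) = fun y => (innerSL ℝ v) ∘L
      fderiv ℝ (chartParam p) y := funext h1
  rw [h4, h3.fderiv] at h0
  have h5 := DFunLike.congr_fun (DFunLike.congr_fun h0 u) w
  rw [real_inner_comm]
  simpa using h5

/-- A pointwise criterion, because the radial retraction is smooth only away from the origin. -/
theorem sph_contMDiffAt_of_coe {m : ℕ} {f : EuclideanSpace ℝ (Fin m) → Sph n}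
    {x : EuclideanSpace ℝ (Fin m)}
    (hf : ContDiffAt ℝ ∞ (fun y => (f y : EuclideanSpace ℝ (Fin (n + 1)))) x) :
    ContMDiffAt (𝓡 m) (𝓡 n) ∞ f x := by
  have := fact_finrank_euclideanSpace_succ n
  rw [contMDiffAt_iff_target]
  refine ⟨Topology.IsInducing.subtypeVal.continuousAt_iff.2 hf.continuousAt, ?_⟩
  let U := (OrthonormalBasis.fromOrthogonalSpanSingleton (𝕜 := ℝ) n
      (ne_zero_of_mem_unit_sphere (-(f x)))).repr
  have h1 : ContDiffAt ℝ ∞ (stereoToFun (-(f x) : EuclideanSpace ℝ (Fin (n + 1)))) (f x) := by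
    refine contDiffOn_stereoToFun.contDiffAt (IsOpen.mem_nhds ?_ ?_)
    · exact isOpen_ne_fun (innerSL ℝ _).continuous continuous_const
    · have : ⟪(f x : EuclideanSpace ℝ (Fin (n + 1))), f x⟫ = 1 := by
        rw [real_inner_self_eq_norm_sq]
        simp
      simp only [mem_ofPred_eq, innerSL_apply_apply, inner_neg_left, this]
      norm_num
  have h2 := U.contDiff.contDiffAt.comp x (h1.comp x hf)
  exact h2.contMDiffAt

end SphereCharts

end

noncomputable section

open Filter Topology Bundle Metric

/-! ### Extension of the metric to the ambient space -/

section AmbientForm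

variable {n : ℕ}

/-- The radial retraction `x ↦ x / |x|` onto the sphere (with an irrelevant value at the origin). -/
def radialRetraction (n : ℕ) (x : EuclideanSpace ℝ (Fin (n + 1))) : Sph n :=
  if h : x = 0 then ⟨EuclideanSpace.single 0 1, by simp⟩
  else ⟨‖x‖⁻¹ • x, by simp [norm_smul, h]⟩

theorem coe_radialRetraction {x : EuclideanSpace ℝ (Fin (n + 1))} (hx : x ≠ 0) :
    (radialRetraction n x : EuclideanSpace ℝ (Fin (n + 1))) = ‖x‖⁻¹ • x := by
  rw [radialRetraction, dif_neg hx]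

theorem sph_coe_ne_zero (x : Sph n) : (x : EuclideanSpace ℝ (Fin (n + 1))) ≠ 0 :=
  ne_zero_of_mem_unit_sphere x

theorem radialRetraction_coe (x : Sph n) : radialRetraction n x = x :=
  Subtype.ext (by rw [coe_radialRetraction (sph_coe_ne_zero x)]; simp)

theorem contMDiffAt_radialRetraction {x : EuclideanSpace ℝ (Fin (n + 1))} (hx : x ≠ 0) :
    ContMDiffAt (𝓡 (n + 1)) (𝓡 n) ∞ (radialRetraction n) x := by
  refine sph_contMDiffAt_of_coe ?_
  have h : ContDiffAt ℝ ∞ (fun y : EuclideanSpace ℝ (Fin (n + 1)) => ‖y‖⁻¹ • y) x :=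
    ((contDiffAt_norm ℝ hx).inv (by simpa using hx)).smul contDiffAt_id
  refine h.congr_of_eventuallyEq ?_
  filter_upwards [isOpen_ne.mem_nhds hx] with y hy
  exact coe_radialRetraction hy

theorem mdifferentiableAt_radialRetraction {x : EuclideanSpace ℝ (Fin (n + 1))} (hx : x ≠ 0) :
    MDifferentiableAt (𝓡 (n + 1)) (𝓡 n) (radialRetraction n) x :=
  (contMDiffAt_radialRetraction hx).mdifferentiableAt (by simp)

/-- The pull-back of a metric on the sphere by the radial retraction. -/
def radialForm (g : RiemMetric n (Sph n)) (x : EuclideanSpace ℝ (Fin (n + 1))) :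
    EuclideanSpace ℝ (Fin (n + 1)) →L[ℝ] EuclideanSpace ℝ (Fin (n + 1)) →L[ℝ] ℝ :=
  let L : EuclideanSpace ℝ (Fin (n + 1)) →L[ℝ] EuclideanSpace ℝ (Fin n) :=
    mfderiv (𝓡 (n + 1)) (𝓡 n) (radialRetraction n) x
  let B : EuclideanSpace ℝ (Fin n) →L[ℝ] EuclideanSpace ℝ (Fin n) →L[ℝ] ℝ :=
    g.inner (radialRetraction n x)
  B.bilinearComp L L

theorem radialForm_apply (g : RiemMetric n (Sph n)) (x u v : EuclideanSpace ℝ (Fin (n + 1))) :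
    radialForm g x u v = g.inner (radialRetraction n x)
      (mfderiv (𝓡 (n + 1)) (𝓡 n) (radialRetraction n) x u)
      (mfderiv (𝓡 (n + 1)) (𝓡 n) (radialRetraction n) x v) := rfl

theorem contDiffAt_radialForm (g : RiemMetric n (Sph n)) {x : EuclideanSpace ℝ (Fin (n + 1))}
    (hx : x ≠ 0) : ContDiffAt ℝ ∞ (radialForm g) x := by
  have h := contMDiffAt_section_pullback (b := g.inner) (b' := radialForm g)
    (contMDiffAt_radialRetraction hx) (Eventually.of_forall fun y u v => rfl) (g.contMDiff _)
  have h2 := (contMDiffAt_section_iff_chartForm (m := n + 1) (radialForm g) x).1 h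
  -- The preferred chart of a vector space is the identity.
  have h3 : chartForm (m := n + 1) (radialForm g) x = radialForm g := by
    funext y
    ext u v
    have hid : ((extChartAt (𝓡 (n + 1)) x).symm :
        EuclideanSpace ℝ (Fin (n + 1)) → EuclideanSpace ℝ (Fin (n + 1))) = id := by
      rw [extChartAt_model_space_eq_id]
      rfl
    change radialForm g ((extChartAt (𝓡 (n + 1)) x).symm y)
      (mfderiv (𝓡 (n + 1)) (𝓡 (n + 1)) (extChartAt (𝓡 (n + 1)) x).symm y u)
      (mfderiv (𝓡 (n + 1)) (𝓡 (n + 1)) (extChartAt (𝓡 (n + 1)) x).symm y v) = _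
    rw [hid, mfderiv_id]
    rfl
  rw [h3, extChartAt_model_space_eq_id] at h2
  exact h2

/-- The field of inner products on `ℝⁿ⁺¹` (outside of the origin) which is the pull-back of the
metric by the radial retraction plus the square of the form `⟨x, ·⟩`. -/
def ambientForm (g : RiemMetric n (Sph n)) (x : EuclideanSpace ℝ (Fin (n + 1))) :
    EuclideanSpace ℝ (Fin (n + 1)) →L[ℝ] EuclideanSpace ℝ (Fin (n + 1)) →L[ℝ] ℝ :=
  radialForm g x + (innerSL ℝ x).smulRight (innerSL ℝ x)

theorem ambientForm_apply (g : RiemMetric n (Sph n)) (x u v : EuclideanSpace ℝ (Fin (n + 1))) :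
    ambientForm g x u v = radialForm g x u v + ⟪x, u⟫ * ⟪x, v⟫ := by
  simp [ambientForm]

theorem contDiffAt_ambientForm (g : RiemMetric n (Sph n)) {x : EuclideanSpace ℝ (Fin (n + 1))}
    (hx : x ≠ 0) : ContDiffAt ℝ ∞ (ambientForm g) x := by
  refine (contDiffAt_radialForm g hx).add ?_
  have h : ContDiffAt ℝ ∞ (fun x : EuclideanSpace ℝ (Fin (n + 1)) => innerSL ℝ x) x :=
    (innerSL ℝ (E := EuclideanSpace ℝ (Fin (n + 1)))).contDiff.contDiffAt
  exact h.smulRight h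

set_option synthInstance.maxHeartbeats 100000 in
theorem hasFDerivAt_ambientForm (g : RiemMetric n (Sph n)) {x : EuclideanSpace ℝ (Fin (n + 1))}
    (hx : x ≠ 0) : HasFDerivAt (ambientForm g) (fderiv ℝ (ambientForm g) x) x :=
  ((contDiffAt_ambientForm g hx).differentiableAt (by simp)).hasFDerivAt

theorem ambientForm_symm (g : RiemMetric n (Sph n)) (x u v : EuclideanSpace ℝ (Fin (n + 1))) :
    ambientForm g x u v = ambientForm g x v u := by
  rw [ambientForm_apply, ambientForm_apply, radialForm_apply, radialForm_apply, g.symm,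
    mul_comm ⟪x, u⟫]

/-- The retraction is constant along rays. -/
theorem mfderiv_radialRetraction_self {x : EuclideanSpace ℝ (Fin (n + 1))} (hx : x ≠ 0) :
    mfderiv (𝓡 (n + 1)) (𝓡 n) (radialRetraction n) x x = 0 := by
  have h1 : HasFDerivAt (fun t : ℝ => t • x) ((ContinuousLinearMap.id ℝ ℝ).smulRight x) 1 :=
    (hasFDerivAt_id (1 : ℝ)).smul_const x
  have h2 : MDifferentiableAt 𝓘(ℝ, ℝ) (𝓡 (n + 1)) (fun t : ℝ => t • x) 1 :=
    h1.differentiableAt.mdifferentiableAt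
  have h3 : MDifferentiableAt (𝓡 (n + 1)) (𝓡 n) (radialRetraction n) ((1 : ℝ) • x) :=
    mdifferentiableAt_radialRetraction (by simpa using hx)
  have h4 := mfderiv_comp (1 : ℝ) h3 h2
  have h5 : radialRetraction n ∘ (fun t : ℝ => t • x) =ᶠ[𝓝 1] fun _ => radialRetraction n x := by
    filter_upwards [lt_mem_nhds (zero_lt_one' ℝ)] with t ht
    refine Subtype.ext ?_
    simp only [Function.comp_apply]
    rw [coe_radialRetraction hx, coe_radialRetraction (smul_ne_zero ht.ne' hx), norm_smul,
      Real.norm_of_nonneg ht.le, smul_smul]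
    congr 1
    field_simp
  rw [h5.mfderiv_eq, mfderiv_const, mfderiv_eq_fderiv, h1.fderiv] at h4
  have h6 := DFunLike.congr_fun h4 (1 : ℝ)
  have h7 : mfderiv (𝓡 (n + 1)) (𝓡 n) (radialRetraction n) ((1 : ℝ) • x) ((1 : ℝ) • x) = 0 :=
    h6.symm
  rw [one_smul] at h7
  exact h7

/-- The retraction kills the radial direction, so only the square of ⟨p, ·⟩ contributes. Thus `p` is
a unit normal to the sphere for the extended form too, whatever `g` is. -/
theorem ambientForm_self_left (g : RiemMetric n (Sph n)) (p : Sph n)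
    (w : EuclideanSpace ℝ (Fin (n + 1))) :
    ambientForm g p p w = ⟪(p : EuclideanSpace ℝ (Fin (n + 1))), w⟫ := by
  rw [ambientForm_apply, radialForm_apply, mfderiv_radialRetraction_self (sph_coe_ne_zero p)]
  rw [map_zero, zero_apply, real_inner_self_eq_norm_sq]
  simp

theorem mfderiv_radialRetraction_coe (p : Sph n) (u : TangentSpace (𝓡 n) p) :
    mfderiv (𝓡 (n + 1)) (𝓡 n) (radialRetraction n) p
      (mfderiv (𝓡 n) (𝓡 (n + 1)) ((↑) : Sph n → EuclideanSpace ℝ (Fin (n + 1))) p u) = u := by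
  have h := mfderiv_comp p (mdifferentiableAt_radialRetraction (sph_coe_ne_zero p))
    ((contMDiff_coe_sph p).mdifferentiableAt (by simp))
  have h1 : radialRetraction n ∘ ((↑) : Sph n → EuclideanSpace ℝ (Fin (n + 1))) = id :=
    funext radialRetraction_coe
  rw [h1, mfderiv_id] at h
  exact (DFunLike.congr_fun h u).symm

theorem RiemMetric.inner_congr_point (g : RiemMetric n (Sph n)) {x y : Sph n} (h : x = y)
    (a b : EuclideanSpace ℝ (Fin n)) :
    g.inner x (a : TangentSpace (𝓡 n) x) (b : TangentSpace (𝓡 n) x) =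
      g.inner y (a : TangentSpace (𝓡 n) y) (b : TangentSpace (𝓡 n) y) := by
  subst h
  rfl

/-- The retraction is the identity on the sphere, and the added square vanishes on vectors tangent
to it. -/
theorem metricInChart_eq_formPullback (g : RiemMetric n (Sph n)) (p : Sph n) :
    metricInChart g p = formPullback (ambientForm g) (chartParam p) := by
  funext y
  ext u v
  have hne : chartParam p y ≠ 0 := sph_coe_ne_zero _
  have hd : MDifferentiableAt (𝓡 n) (𝓡 (n + 1)) (chartParam p) y :=
    (((contDiff_chartParam p).differentiable (by simp)) y).mdifferentiableAt
  have hcomp := mfderiv_comp y (mdifferentiableAt_radialRetraction hne) hd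
  have h1 : radialRetraction n ∘ chartParam p = (extChartAt (𝓡 n) p).symm :=
    funext fun y => radialRetraction_coe _
  rw [h1, mfderiv_eq_fderiv] at hcomp
  have hu : ∀ u, mfderiv (𝓡 n) (𝓡 n) (extChartAt (𝓡 n) p).symm y u =
      mfderiv (𝓡 (n + 1)) (𝓡 n) (radialRetraction n) (chartParam p y)
        (fderiv ℝ (chartParam p) y u) := fun u => DFunLike.congr_fun hcomp u
  have hperp : ∀ u, ⟪chartParam p y, fderiv ℝ (chartParam p) y u⟫ = 0 := by
    intro u
    have h2 := ((contDiff_chartParam p).differentiable (by simp) y).hasFDerivAt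
    have h3 := h2.inner ℝ h2
    have h4 : (fun y => ⟪chartParam p y, chartParam p y⟫) = fun _ => (1 : ℝ) := by
      funext y
      rw [real_inner_self_eq_norm_sq, norm_chartParam, one_pow]
    rw [h4] at h3
    have h5 := DFunLike.congr_fun (h3.unique (hasFDerivAt_const (1 : ℝ) y)) u
    simp only [fderivInnerCLM_apply, ContinuousLinearMap.comp_apply,
      ContinuousLinearMap.prod_apply, zero_apply] at h5
    rw [real_inner_comm] at h5
    linarith [real_inner_comm (chartParam p y) (fderiv ℝ (chartParam p) y u)]
  rw [formPullback_apply, ambientForm_apply, hperp, hperp, radialForm_apply, zero_mul, add_zero]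
  have h6 : (extChartAt (𝓡 n) p).symm y = radialRetraction n (chartParam p y) :=
    (radialRetraction_coe _).symm
  exact (congrArg₂ (fun a b => g.inner ((extChartAt (𝓡 n) p).symm y) a b) (hu u) (hu v)).trans
    (g.inner_congr_point h6 _ _)

end AmbientForm

end

noncomputable section

open Filter Topology Bundle Metric

/-! ### Minimality of equators as an identity for the derivative of the metric -/

section MinimalEquators

variable {n : ℕ}

/-- Without second derivative of F, the Hessian is -DF ∘ Γ. As `ν` is the gradient of F, this is
minus the Christoffel symbol of the first kind paired with `ν`. -/
theorem ChartMeanCurvatureVanishes.sum_eq_zero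
    {G : EuclideanSpace ℝ (Fin n) → EuclideanSpace ℝ (Fin n) →L[ℝ] EuclideanSpace ℝ (Fin n) →L[ℝ] ℝ}
    {F : EuclideanSpace ℝ (Fin n) → ℝ} {y ν : EuclideanSpace ℝ (Fin n)}
    (h : ChartMeanCurvatureVanishes G F y) (hsymm : ∀ u v, G y u v = G y v u)
    (hpos : ∀ v, v ≠ 0 → 0 < G y v v) (hF : ∀ w, fderiv ℝ F y w = G y ν w)
    (hF2 : fderiv ℝ (fderiv ℝ F) y = 0) (hν : ν ≠ 0) (e : Fin (n - 1) → EuclideanSpace ℝ (Fin n))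
    (he : ∀ i j, G y (e i) (e j) = if i = j then 1 else 0) (heν : ∀ i, G y ν (e i) = 0) :
    ∑ i, (2 * fderiv ℝ G y (e i) (e i) ν - fderiv ℝ G y ν (e i) (e i)) = 0 := by
  have hgrad : chartGradient G F y = ν := by
    rw [chartGradient, ContinuousLinearMap.inverse_apply_eq_iff_of_pos hpos]
    ext w
    exact (hF w).symm
  have hsqrt : Real.sqrt (G y ν ν) ≠ 0 := (Real.sqrt_pos.2 (hpos ν hν)).ne'
  have hGamma : ∀ u, fderiv ℝ F y (christoffelSecond G y u u) =
      (1 / 2) * (2 * fderiv ℝ G y u u ν - fderiv ℝ G y ν u u) := by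
    intro u
    rw [hF, hsymm]
    have h1 := (ContinuousLinearMap.inverse_apply_eq_iff_of_pos hpos
      (christoffelFirst G y u u) (christoffelSecond G y u u)).1 rfl
    rw [h1, christoffelFirst_apply]
    ring
  have h2 := h e (fun i => by rw [hF, heν]) he
  simp only [chartSecondFundamentalForm, chartHessian, hF2, hgrad, hGamma, zero_apply,
    ← Finset.sum_div, div_eq_zero_iff, hsqrt, or_false, zero_sub, Finset.sum_neg_distrib,
    neg_eq_zero, ← Finset.mul_sum] at h2
  linarith

theorem metricInChart_zero_apply (g : RiemMetric n (Sph n)) (p : Sph n)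
    (u w : EuclideanSpace ℝ (Fin n)) :
    metricInChart g p 0 u w = ambientForm g p (tangentIncl p u) (tangentIncl p w) := by
  rw [metricInChart_eq_formPullback, formPullback_apply, (hasFDerivAt_chartParam p).fderiv,
    chartParam_zero]
  rfl

theorem metricInChart_zero_pos (g : RiemMetric n (Sph n)) (p : Sph n)
    (v : EuclideanSpace ℝ (Fin n)) (hv : v ≠ 0) : 0 < metricInChart g p 0 v v :=
  g.metricInChart_pos p (by rw [extChartAt_sph_target]; trivial) v hv

theorem ambientForm_self_right (g : RiemMetric n (Sph n)) (p : Sph n)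
    (w : EuclideanSpace ℝ (Fin (n + 1))) :
    ambientForm g p w p = ⟪(p : EuclideanSpace ℝ (Fin (n + 1))), w⟫ := by
  rw [ambientForm_symm, ambientForm_self_left]

/-- The correction terms pair a radial second derivative with a tangent vector, and these are
orthogonal for `ambientForm`. -/
theorem fderiv_metricInChart_zero (g : RiemMetric n (Sph n)) (p : Sph n)
    (z u w : EuclideanSpace ℝ (Fin n)) :
    fderiv ℝ (metricInChart g p) 0 z u w =
      fderiv ℝ (ambientForm g) p (tangentIncl p z) (tangentIncl p u) (tangentIncl p w) := by
  have hrad : ∀ a b, ∃ r : ℝ, fderiv ℝ (fderiv ℝ (chartParam p)) 0 a b =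
      r • (p : EuclideanSpace ℝ (Fin (n + 1))) := by
    intro a b
    set x := fderiv ℝ (fderiv ℝ (chartParam p)) 0 a b with hx
    have hmem : x ∈ (ℝ ∙ (p : EuclideanSpace ℝ (Fin (n + 1))))ᗮᗮ := by
      rw [Submodule.mem_orthogonal']
      intro v hv
      exact fderiv_fderiv_chartParam p
        (Submodule.mem_orthogonal_singleton_iff_inner_right.1 hv) a b
    rw [Submodule.orthogonal_orthogonal, Submodule.mem_span_singleton] at hmem
    obtain ⟨r, hr⟩ := hmem
    exact ⟨r, hr.symm⟩
  have hp : ∀ w, ⟪(p : EuclideanSpace ℝ (Fin (n + 1))), tangentIncl p w⟫ = 0 := fun w => by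
    rw [real_inner_comm, inner_tangentIncl]
  rw [metricInChart_eq_formPullback, fderiv_formPullback
    (contDiffAt_ambientForm g (by rw [chartParam_zero]; exact sph_coe_ne_zero p))
    (contDiff_chartParam p).contDiffAt, (hasFDerivAt_chartParam p).fderiv, chartParam_zero]
  obtain ⟨r, hr⟩ := hrad z u
  obtain ⟨s, hs⟩ := hrad z w
  rw [hr, hs]
  simp only [map_smul, smul_apply, LinearIsometry.coe_toContinuousLinearMap,
    ambientForm_self_left, ambientForm_self_right, hp, smul_zero, add_zero]

/-- Regularity: at a point of the equator `v` itself is tangent to the sphere, and the derivative of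
the equation along it is |v|². -/
theorem isLocalEquation_equator {v : EuclideanSpace ℝ (Fin (n + 1))} (hv : v ≠ 0) (p : Sph n) :
    IsLocalEquation (n := n) (equator v) p univ
      (fun x : Sph n => ⟪(x : EuclideanSpace ℝ (Fin (n + 1))), v⟫) := by
  have hsm : ContMDiff (𝓡 n) 𝓘(ℝ, ℝ) ∞
      (fun x : Sph n => ⟪(x : EuclideanSpace ℝ (Fin (n + 1))), v⟫) :=
    (contDiff_id.inner ℝ contDiff_const).contMDiff.comp contMDiff_coe_sph
  refine ⟨isOpen_univ, trivial, hsm.contMDiffOn, fun q _ => Iff.rfl, fun q _ hq h0 => hv ?_⟩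
  obtain ⟨w, hw⟩ := exists_tangentIncl_eq q (v := v) (by rw [real_inner_comm]; exact hq)
  have h1 : MDifferentiableAt (𝓡 n) (𝓡 n) (extChartAt (𝓡 n) q).symm 0 :=
    mdifferentiableAt_extChartAt_symm_of_mem (by rw [extChartAt_sph_target]; trivial)
  have hq0 : (extChartAt (𝓡 n) q).symm 0 = q := Subtype.ext (chartParam_zero q)
  have h2 : MDifferentiableAt (𝓡 n) 𝓘(ℝ, ℝ)
      (fun x : Sph n => ⟪(x : EuclideanSpace ℝ (Fin (n + 1))), v⟫)
      ((extChartAt (𝓡 n) q).symm 0) := (hsm _).mdifferentiableAt (by simp)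
  have h3 := mfderiv_comp (0 : EuclideanSpace ℝ (Fin n)) h2 h1
  rw [hq0, h0, mfderiv_eq_fderiv] at h3
  have h4 : fderiv ℝ (fun y => ⟪chartParam q y, v⟫) 0 w = 0 := DFunLike.congr_fun h3 w
  rw [fderiv_inner_chartParam, hw] at h4
  exact inner_self_eq_zero.1 h4

/-- The infinitesimal form of the minimality of the equators through `p`. -/
theorem cubic_eq_trace_of_isMinimalHypersurface_equator (hn : 1 ≤ n) {g : RiemMetric n (Sph n)}
    (hg : ∀ v : EuclideanSpace ℝ (Fin (n + 1)), v ≠ 0 → IsMinimalHypersurface g (equator v))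
    (p : Sph n) (c : Module.Basis (Fin n) ℝ (EuclideanSpace ℝ (Fin n)))
    (hc : ∀ i j, metricInChart g p 0 (c i) (c j) = if i = j then (1 : ℝ) else 0)
    (v : EuclideanSpace ℝ (Fin n)) :
    (n + 1) * fderiv ℝ (metricInChart g p) 0 v v v =
      2 * metricInChart g p 0 v v * ∑ i, fderiv ℝ (metricInChart g p) 0 v (c i) (c i) := by
  refine cubic_eq_trace hn (metricInChart g p 0)
    (fderiv ℝ (metricInChart g p) 0).toLinearMap ?_ ?_ c hc v
  · intro u v w
    change fderiv ℝ (metricInChart g p) 0 u v w = fderiv ℝ (metricInChart g p) 0 u w v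
    have hd := (g.contDiffAt_metricInChart p).differentiableAt (by simp)
    rw [extChartAt_sph_self] at hd
    have h1 := (hd.hasFDerivAt.clm_apply (hasFDerivAt_const v 0)).clm_apply (hasFDerivAt_const w 0)
    have h2 := (hd.hasFDerivAt.clm_apply (hasFDerivAt_const w 0)).clm_apply (hasFDerivAt_const v 0)
    have h3 : (fun y => metricInChart g p y v w) = fun y => metricInChart g p y w v :=
      funext fun y => g.metricInChart_symm p y v w
    rw [h3] at h1
    simpa using DFunLike.congr_fun (h1.unique h2) u
  · intro e ν he heν hν
    have hν0 : ν ≠ 0 := by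
      rintro rfl
      simp at hν
    -- `ξ` is the Euclidean dual of the form G(ν, ·), so the equation of the equator orthogonal to
    -- `tangentIncl p ξ` has `G`-gradient `ν` at `p`.
    set ξ := (InnerProductSpace.toDual ℝ (EuclideanSpace ℝ (Fin n))).symm (metricInChart g p 0 ν)
      with hξ
    have hξw : ∀ w, ⟪ξ, w⟫ = metricInChart g p 0 ν w := fun w => by
      rw [hξ, InnerProductSpace.toDual_symm_apply]
    have hvw : ∀ w, ⟪tangentIncl p w, tangentIncl p ξ⟫ = metricInChart g p 0 ν w := fun w => by
      rw [LinearIsometry.inner_map_map, real_inner_comm, hξw]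
    have hv0 : tangentIncl p ξ ≠ 0 := by
      intro h0
      have := hvw ν
      rw [h0, inner_zero_right, hν] at this
      exact zero_ne_one this
    have hp : p ∈ equator (tangentIncl p ξ) := by
      change ⟪(p : EuclideanSpace ℝ (Fin (n + 1))), tangentIncl p ξ⟫ = 0
      rw [real_inner_comm, inner_tangentIncl]
    have hmin := (hg _ hv0 p hp).2 _ _ (isLocalEquation_equator hv0 p)
    rw [extChartAt_sph_self] at hmin
    exact hmin.sum_eq_zero (g.metricInChart_symm p 0) (metricInChart_zero_pos g p)
      (fun w => (fderiv_inner_chartParam p _ w).trans (hvw w))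
      (fderiv_fderiv_zero_of_odd (contDiff_inner_chartParam p _) (inner_chartParam_neg p hp))
      hν0 e he heν

/-- A frame at `p` which is orthonormal for the metric `g` and has `p` as first vector. -/
theorem exists_gram_ambientForm_eq_one (hn : 1 ≤ n) {g : RiemMetric n (Sph n)}
    (hg : ∀ v : EuclideanSpace ℝ (Fin (n + 1)), v ≠ 0 → IsMinimalHypersurface g (equator v))
    (p : Sph n) :
    ∃ c : Fin n → EuclideanSpace ℝ (Fin (n + 1)),
      (∀ i, ⟪(p : EuclideanSpace ℝ (Fin (n + 1))), c i⟫ = 0) ∧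
      (∀ i j, ambientForm g p (c i) (c j) = if i = j then (1 : ℝ) else 0) ∧
      ∀ v, ⟪(p : EuclideanSpace ℝ (Fin (n + 1))), v⟫ = 0 →
        (n + 1) * fderiv ℝ (ambientForm g) p v v v =
          2 * ambientForm g p v v * ∑ i, fderiv ℝ (ambientForm g) p v (c i) (c i) := by
  obtain ⟨c, hc⟩ := exists_basis_orthonormal n finrank_euclideanSpace_fin
    ((ContinuousLinearMap.coeLM ℝ).comp (metricInChart g p 0).toLinearMap)
    (g.metricInChart_symm p 0) (metricInChart_zero_pos g p)
  have hc' : ∀ i j, metricInChart g p 0 (c i) (c j) = if i = j then (1 : ℝ) else 0 := hc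
  refine ⟨fun i => tangentIncl p (c i), fun i => ?_, fun i j => ?_, fun v hv => ?_⟩
  · rw [real_inner_comm, inner_tangentIncl]
  · rw [← metricInChart_zero_apply, hc']
  · obtain ⟨w, rfl⟩ := exists_tangentIncl_eq p (by rw [real_inner_comm]; exact hv)
    have h := cubic_eq_trace_of_isMinimalHypersurface_equator hn hg p c hc' w
    simpa only [fderiv_metricInChart_zero, metricInChart_zero_apply] using h

/-- A general `ρ` serves both points: the same frame has ρ = 1 at `x` and an unknown conformal
factor at `-x`. -/
theorem gram_cons_eq {B : EuclideanSpace ℝ (Fin (n + 1)) →L[ℝ] EuclideanSpace ℝ (Fin (n + 1)) →L[ℝ] ℝ}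
    {x : EuclideanSpace ℝ (Fin (n + 1))} {c : Fin n → EuclideanSpace ℝ (Fin (n + 1))} {ρ : ℝ}
    (hx : B x x = 1) (hxc : ∀ i, B x (c i) = 0) (hcx : ∀ i, B (c i) x = 0)
    (hc : ∀ i j, B (c i) (c j) = if i = j then ρ else 0) :
    gram B (Fin.cons x c) = Matrix.diagonal (Fin.cons 1 fun _ => ρ) := by
  ext i j
  simp only [gram, Matrix.of_apply, Matrix.diagonal_apply]
  refine Fin.cases ?_ (fun i => ?_) i <;> refine Fin.cases ?_ (fun j => ?_) j
  · simpa using hx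
  · simpa [(Fin.succ_ne_zero j).symm] using hxc j
  · simpa [Fin.succ_ne_zero i] using hcx i
  · simpa using hc i j

end MinimalEquators

end

noncomputable section

open Filter Topology Bundle Metric

/-! ### A conserved quantity along great circles -/

section GreatCircle

/-- The hypotheses are (n+1) q'/q = 2 D'/D with τ = D'/D, written without division by q. -/
theorem HasDerivAt.pow_mul_inv_sq {q D : ℝ → ℝ} {q' τ t : ℝ} {n : ℕ} (hq : HasDerivAt q q' t)
    (hD : HasDerivAt D (D t * τ) t) (hD0 : D t ≠ 0) (h : (n + 1) * q' = 2 * q t * τ) :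
    HasDerivAt (fun s => q s ^ (n + 1) * (D s ^ 2)⁻¹) 0 t := by
  refine ((hq.fun_pow (n + 1)).fun_mul
    ((hD.fun_pow 2).fun_inv (pow_ne_zero 2 hD0))).congr_deriv ?_
  simp only [Nat.add_sub_cancel]
  push_cast
  field_simp
  linear_combination q t ^ n * h

variable {n : ℕ}

/-- The great circle through `p` with initial velocity `v`. -/
def greatCircle (p v : EuclideanSpace ℝ (Fin (n + 1))) (t : ℝ) : EuclideanSpace ℝ (Fin (n + 1)) :=
  Real.cos t • p + Real.sin t • v

/-- The velocity of `greatCircle p v`. -/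
def greatCircleVel (p v : EuclideanSpace ℝ (Fin (n + 1))) (t : ℝ) :
    EuclideanSpace ℝ (Fin (n + 1)) :=
  Real.cos t • v - Real.sin t • p

theorem hasDerivAt_greatCircle (p v : EuclideanSpace ℝ (Fin (n + 1))) (t : ℝ) :
    HasDerivAt (greatCircle p v) (greatCircleVel p v t) t := by
  refine (((Real.hasDerivAt_cos t).smul_const p).add
    ((Real.hasDerivAt_sin t).smul_const v)).congr_deriv ?_
  rw [greatCircleVel, neg_smul, neg_add_eq_sub]

theorem hasDerivAt_greatCircleVel (p v : EuclideanSpace ℝ (Fin (n + 1))) (t : ℝ) :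
    HasDerivAt (greatCircleVel p v) (-greatCircle p v t) t := by
  refine (((Real.hasDerivAt_cos t).smul_const v).sub
    ((Real.hasDerivAt_sin t).smul_const p)).congr_deriv ?_
  rw [greatCircle, neg_smul]
  abel

variable {p v : EuclideanSpace ℝ (Fin (n + 1))}

theorem norm_greatCircle (hp : ‖p‖ = 1) (hv : ‖v‖ = 1) (hpv : ⟪p, v⟫ = 0) (t : ℝ) :
    ‖greatCircle p v t‖ = 1 := by
  have hpp : ⟪p, p⟫ = 1 := by rw [real_inner_self_eq_norm_sq, hp, one_pow]
  have hvv : ⟪v, v⟫ = 1 := by rw [real_inner_self_eq_norm_sq, hv, one_pow]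
  have h : ‖greatCircle p v t‖ ^ 2 = 1 := by
    rw [← real_inner_self_eq_norm_sq, greatCircle]
    simp only [inner_add_left, inner_add_right, real_inner_smul_left, real_inner_smul_right,
      hpp, hvv, hpv, real_inner_comm p v]
    linear_combination Real.cos_sq_add_sin_sq t
  nlinarith [norm_nonneg (greatCircle p v t)]

theorem inner_greatCircle_greatCircleVel (hp : ‖p‖ = 1) (hv : ‖v‖ = 1) (hpv : ⟪p, v⟫ = 0) (t : ℝ) :
    ⟪greatCircle p v t, greatCircleVel p v t⟫ = 0 := by
  have hpp : ⟪p, p⟫ = 1 := by rw [real_inner_self_eq_norm_sq, hp, one_pow]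
  have hvv : ⟪v, v⟫ = 1 := by rw [real_inner_self_eq_norm_sq, hv, one_pow]
  rw [greatCircle, greatCircleVel]
  simp only [inner_add_left, inner_sub_right, real_inner_smul_left, real_inner_smul_right,
    hpp, hvv, hpv, real_inner_comm p v]
  ring

theorem ambientForm_pos (g : RiemMetric n (Sph n)) (x : Sph n) {v : EuclideanSpace ℝ (Fin (n + 1))}
    (hv : ⟪(x : EuclideanSpace ℝ (Fin (n + 1))), v⟫ = 0) (hv0 : v ≠ 0) :
    0 < ambientForm g x v v := by
  obtain ⟨w, rfl⟩ := exists_tangentIncl_eq x (by rw [real_inner_comm]; exact hv)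
  rw [← metricInChart_zero_apply]
  refine metricInChart_zero_pos g x w ?_
  rintro rfl
  simp at hv0

/-- The determinant of the metric `ambientForm g x` in the standard basis. -/
def ambientDet (g : RiemMetric n (Sph n)) (x : EuclideanSpace ℝ (Fin (n + 1))) : ℝ :=
  (gram (ambientForm g x) (EuclideanSpace.basisFun (Fin (n + 1)) ℝ)).det

theorem gram_ambientForm_cons (g : RiemMetric n (Sph n)) (x : Sph n)
    {c : Fin n → EuclideanSpace ℝ (Fin (n + 1))}
    (h1 : ∀ i, ⟪(x : EuclideanSpace ℝ (Fin (n + 1))), c i⟫ = 0)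
    (h2 : ∀ i j, ambientForm g x (c i) (c j) = if i = j then (1 : ℝ) else 0) :
    gram (ambientForm g x) (Fin.cons (x : EuclideanSpace ℝ (Fin (n + 1))) c) = 1 := by
  rw [gram_cons_eq (ρ := 1) (by rw [ambientForm_self_left, real_inner_self_eq_norm_sq]; simp)
    (fun i => by rw [ambientForm_self_left, h1]) (fun i => by rw [ambientForm_self_right, h1]) h2]
  rw [← Matrix.diagonal_one]
  congr 1
  ext i
  refine Fin.cases ?_ (fun i => ?_) i <;> simp

variable (hn : 1 ≤ n) {g : RiemMetric n (Sph n)}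
    (hg : ∀ v : EuclideanSpace ℝ (Fin (n + 1)), v ≠ 0 → IsMinimalHypersurface g (equator v))

include hn hg in
theorem ambientDet_ne_zero (x : Sph n) : ambientDet g x ≠ 0 := by
  obtain ⟨c, h1, h2, -⟩ := exists_gram_ambientForm_eq_one hn hg x
  have h3 := det_gram_eq (ambientForm g x) (Fin.cons (x : EuclideanSpace ℝ (Fin (n + 1))) c)
  rw [gram_ambientForm_cons g x h1 h2, Matrix.det_one] at h3
  exact right_ne_zero_of_mul_eq_one h3.symm

set_option synthInstance.maxHeartbeats 100000 in
theorem hasDerivAt_ambientForm_greatCircle (g : RiemMetric n (Sph n)) (hp : ‖p‖ = 1)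
    (hv : ‖v‖ = 1) (hpv : ⟪p, v⟫ = 0) (t : ℝ) :
    HasDerivAt (fun s => ambientForm g (greatCircle p v s))
      (fderiv ℝ (ambientForm g) (greatCircle p v t) (greatCircleVel p v t)) t := by
  have hne : greatCircle p v t ≠ 0 := by
    intro h
    have := norm_greatCircle hp hv hpv t
    rw [h, norm_zero] at this
    exact zero_ne_one this
  exact HasFDerivAt.comp_hasDerivAt (l := ambientForm g)
    (l' := fderiv ℝ (ambientForm g) (greatCircle p v t)) t
    (hasFDerivAt_ambientForm g hne) (hasDerivAt_greatCircle p v t)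

include hn hg in
/-- Along a great circle, the square of the speed and the determinant of the metric are linked. -/
theorem hasDerivAt_speed_pow_div_det (hp : ‖p‖ = 1) (hv : ‖v‖ = 1) (hpv : ⟪p, v⟫ = 0) (t : ℝ) :
    HasDerivAt (fun s => ambientForm g (greatCircle p v s) (greatCircleVel p v s)
        (greatCircleVel p v s) ^ (n + 1) * (ambientDet g (greatCircle p v s) ^ 2)⁻¹) 0 t := by
  set x : Sph n := ⟨greatCircle p v t, by simpa using norm_greatCircle hp hv hpv t⟩ with hx
  have hxt : (x : EuclideanSpace ℝ (Fin (n + 1))) = greatCircle p v t := rfl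
  set w := greatCircleVel p v t with hw
  have hxw : ⟪(x : EuclideanSpace ℝ (Fin (n + 1))), w⟫ = 0 :=
    inner_greatCircle_greatCircleVel hp hv hpv t
  have hB := hasDerivAt_ambientForm_greatCircle g hp hv hpv t
  rw [← hxt, ← hw] at hB
  have hγ := hasDerivAt_greatCircle p v t
  have hγ' := hasDerivAt_greatCircleVel p v t
  obtain ⟨c, h1, h2, h3⟩ := exists_gram_ambientForm_eq_one hn hg x
  -- The position vector keeps length 1 along the circle and is orthogonal to its velocity. Hence
  -- the radial vector of the frame adds nothing to the trace.
  have hself : fderiv ℝ (ambientForm g) x w x x = 0 := by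
    have h4 := (hB.clm_apply hγ).clm_apply hγ
    have h5 : (fun s => ambientForm g (greatCircle p v s) (greatCircle p v s)
        (greatCircle p v s)) = fun _ => (1 : ℝ) := by
      funext s
      have h6 := norm_greatCircle hp hv hpv s
      have h7 := ambientForm_self_left g ⟨greatCircle p v s, by simpa using h6⟩ (greatCircle p v s)
      rw [h7, real_inner_self_eq_norm_sq, h6, one_pow]
    rw [h5] at h4
    have h8 := h4.unique (hasDerivAt_const t (1 : ℝ))
    simp only [add_apply, ← hxt, ← hw, ambientForm_self_left, ambientForm_self_right, hxw] at h8
    linarith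
  have hdet : HasDerivAt (fun s => ambientDet g (greatCircle p v s))
      (ambientDet g x * ∑ i, fderiv ℝ (ambientForm g) x w (c i) (c i)) t := by
    have h4 := hasDerivAt_det_gram hB _ (gram_ambientForm_cons g x h1 h2)
    refine h4.congr_deriv ?_
    rw [Fin.sum_univ_succ]
    simp only [Fin.cons_zero, Fin.cons_succ, hself, zero_add]
    rfl
  -- The acceleration is -γ, orthogonal to the velocity, so only the derivative of the form remains.
  have hq : HasDerivAt (fun s => ambientForm g (greatCircle p v s) (greatCircleVel p v s)
      (greatCircleVel p v s)) (fderiv ℝ (ambientForm g) x w w w) t := by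
    have h4 := (hB.clm_apply hγ').clm_apply hγ'
    refine h4.congr_deriv ?_
    simp only [add_apply, ← hxt, ← hw, map_neg, neg_apply, ambientForm_self_left,
      ambientForm_self_right, hxw]
    ring
  have hD0 : ambientDet g (greatCircle p v t) ≠ 0 := ambientDet_ne_zero hn hg x
  exact hq.pow_mul_inv_sq hdet hD0 (h3 w hxw)

-- The conserved quantity is compared at times 0 and π: the circle reaches -x with velocity -w, and
-- the sign disappears in the quadratic form.
include hn hg in
theorem ambientForm_neg_pow_mul (x : Sph n) {w : EuclideanSpace ℝ (Fin (n + 1))}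
    (hw : ‖w‖ = 1) (hxw : ⟪(x : EuclideanSpace ℝ (Fin (n + 1))), w⟫ = 0) :
    ambientForm g (-x : Sph n) w w ^ (n + 1) =
      ambientForm g x w w ^ (n + 1) * (ambientDet g (-x : Sph n) / ambientDet g x) ^ 2 := by
  have hx1 : ‖(x : EuclideanSpace ℝ (Fin (n + 1)))‖ = 1 := by simp
  have hd := hasDerivAt_speed_pow_div_det hn hg hx1 hw hxw
  have h := is_const_of_deriv_eq_zero (fun t => (hd t).differentiableAt) (fun t => (hd t).deriv)
    Real.pi 0
  simp only [greatCircle, greatCircleVel, Real.cos_pi, Real.sin_pi, Real.cos_zero, Real.sin_zero,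
    neg_smul, one_smul, zero_smul, add_zero, sub_zero, map_neg, neg_apply, neg_neg] at h
  have h1 := ambientDet_ne_zero hn hg x
  have h2 := ambientDet_ne_zero hn hg (-x)
  rw [coe_neg_sphere] at h2 ⊢
  field_simp at h ⊢
  linear_combination h

end GreatCircle

/-! ### Antipodal invariance of the metric -/

section Antipodal

variable {n : ℕ} {g : RiemMetric n (Sph n)}

/-- A metric for which all equators are minimal takes the same values at antipodal points. -/
theorem ambientForm_neg (hn : 2 ≤ n)
    (hg : ∀ v : EuclideanSpace ℝ (Fin (n + 1)), v ≠ 0 → IsMinimalHypersurface g (equator v))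
    (x : Sph n) {u w : EuclideanSpace ℝ (Fin (n + 1))}
    (hu : ⟪(x : EuclideanSpace ℝ (Fin (n + 1))), u⟫ = 0)
    (hw : ⟪(x : EuclideanSpace ℝ (Fin (n + 1))), w⟫ = 0) :
    ambientForm g (-x : Sph n) u w = ambientForm g x u w := by
  have hn1 : 1 ≤ n := by omega
  set K := (ambientDet g (-x : Sph n) / ambientDet g x) ^ 2 with hK
  have hK0 : 0 ≤ K := sq_nonneg _
  -- The same factor `K` occurs for every direction `w`, so its (n+1)-st root is a conformal factor
  -- between the two points.
  set ρ := K ^ (((n + 1 : ℕ) : ℝ)⁻¹) with hρdef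
  have hρ0 : 0 ≤ ρ := Real.rpow_nonneg hK0 _
  have hρ : ρ ^ (n + 1) = K := Real.rpow_inv_natCast_pow hK0 (by omega)
  have hunit : ∀ w, ‖w‖ = 1 → ⟪(x : EuclideanSpace ℝ (Fin (n + 1))), w⟫ = 0 →
      ambientForm g (-x : Sph n) w w = ρ * ambientForm g x w w := by
    intro w hw1 hxw
    have hw0 : w ≠ 0 := by
      rintro rfl
      simp at hw1
    have hnx : ⟪((-x : Sph n) : EuclideanSpace ℝ (Fin (n + 1))), w⟫ = 0 := by
      rw [coe_neg_sphere, inner_neg_left, hxw, neg_zero]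
    refine (pow_left_inj₀ (ambientForm_pos g (-x) hnx hw0).le
      (mul_nonneg hρ0 (ambientForm_pos g x hxw hw0).le) (Nat.succ_ne_zero n)).1 ?_
    rw [Nat.succ_eq_add_one, mul_pow, hρ, ambientForm_neg_pow_mul hn1 hg x hw1 hxw]
    ring
  have hdiag : ∀ w, ⟪(x : EuclideanSpace ℝ (Fin (n + 1))), w⟫ = 0 →
      ambientForm g (-x : Sph n) w w = ρ * ambientForm g x w w := by
    intro w hxw
    rcases eq_or_ne w 0 with rfl | hw0
    · simp
    · have hw0' : ‖w‖ ≠ 0 := by simpa using hw0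
      have h := hunit (‖w‖⁻¹ • w) (by simp [norm_smul, hw0])
        (by rw [real_inner_smul_right, hxw, mul_zero])
      simp only [map_smul, smul_apply, smul_eq_mul] at h
      field_simp at h
      exact h
  have hall : ∀ u w, ⟪(x : EuclideanSpace ℝ (Fin (n + 1))), u⟫ = 0 →
      ⟪(x : EuclideanSpace ℝ (Fin (n + 1))), w⟫ = 0 →
      ambientForm g (-x : Sph n) u w = ρ * ambientForm g x u w := by
    intro u w hu hw
    have h1 := hdiag (u + w) (by rw [inner_add_right, hu, hw, add_zero])
    have h2 := hdiag u hu
    have h3 := hdiag w hw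
    simp only [map_add, add_apply] at h1
    rw [ambientForm_symm g _ w u, ambientForm_symm g x w u] at h1
    linarith
  obtain ⟨c, h1, h2, -⟩ := exists_gram_ambientForm_eq_one hn1 hg x
  have hxx : ⟪(x : EuclideanSpace ℝ (Fin (n + 1))), x⟫ = 1 := by
    rw [real_inner_self_eq_norm_sq]
    simp
  have hleft : ∀ w, ambientForm g (-x : Sph n) x w = ⟪(x : EuclideanSpace ℝ (Fin (n + 1))), w⟫ := by
    intro w
    have h := ambientForm_self_left g (-x) w
    rw [coe_neg_sphere, map_neg, neg_apply, inner_neg_left] at h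
    rw [coe_neg_sphere]
    exact neg_injective h
  have hgram : gram (ambientForm g (-x : Sph n)) (Fin.cons (x : EuclideanSpace ℝ (Fin (n + 1))) c) =
      Matrix.diagonal (Fin.cons 1 fun _ => ρ) :=
    gram_cons_eq (by rw [hleft, hxx]) (fun i => by rw [hleft, h1])
      (fun i => by rw [ambientForm_symm, hleft, h1])
      (fun i j => by rw [hall _ _ (h1 i) (h1 j), h2]; simp)
  have hd1 := det_gram_eq (ambientForm g x) (Fin.cons (x : EuclideanSpace ℝ (Fin (n + 1))) c)
  have hd2 := det_gram_eq (ambientForm g (-x : Sph n))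
    (Fin.cons (x : EuclideanSpace ℝ (Fin (n + 1))) c)
  rw [gram_ambientForm_cons g x h1 h2, Matrix.det_one] at hd1
  rw [hgram, Matrix.det_diagonal, Fin.prod_univ_succ] at hd2
  simp only [Fin.cons_zero, Fin.cons_succ, Finset.prod_const, Finset.card_univ, Fintype.card_fin,
    one_mul] at hd2
  have hD := ambientDet_ne_zero hn1 hg x
  -- A second evaluation of the determinant ratio, from a frame orthonormal at x: only its n tangent
  -- vectors are rescaled.
  have hratio : ambientDet g (-x : Sph n) / ambientDet g x = ρ ^ n := by
    rw [div_eq_iff hD, hd2]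
    change _ = _ * ambientDet g (-x : Sph n) * ambientDet g x
    change _ = _ * ambientDet g x at hd1
    linear_combination ambientDet g (-x : Sph n) * hd1
  have hρpos : 0 < ρ := by
    refine hρ0.lt_of_ne ?_
    intro h0
    have hD' := ambientDet_ne_zero hn1 hg (-x)
    rw [← h0, zero_pow (by omega), div_eq_zero_iff] at hratio
    exact hratio.elim hD' hD
  -- The two evaluations give ρ^(2n) = ρ^(n+1), hence ρ^(n-1) = 1. The exponent is nonzero because n
  -- ≥ 2.
  have hρ1 : ρ = 1 := by
    rw [hK, hratio, ← pow_mul] at hρ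
    have h3 : n * 2 = (n + 1) + (n - 1) := by omega
    rw [h3, pow_add ρ (n + 1) (n - 1)] at hρ
    have h4 : ρ ^ (n - 1) = 1 := by
      have h5 : ρ ^ (n + 1) ≠ 0 := pow_ne_zero _ hρpos.ne'
      exact mul_left_cancel₀ h5 (by rw [mul_one]; exact hρ.symm)
    exact (pow_eq_one_iff_of_nonneg hρ0 (by omega)).1 h4
  rw [hall u w hu hw, hρ1, one_mul]

end Antipodal

end

noncomputable section

open Filter Topology Bundle Metric

section PullbackComp

variable {n : ℕ}
  {M : Type*} [TopologicalSpace M] [ChartedSpace (EuclideanSpace ℝ (Fin n)) M]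
  [IsManifold (𝓡 n) ∞ M]
  {N : Type*} [TopologicalSpace N] [ChartedSpace (EuclideanSpace ℝ (Fin n)) N]
  [IsManifold (𝓡 n) ∞ N]
  {P : Type*} [TopologicalSpace P] [ChartedSpace (EuclideanSpace ℝ (Fin n)) P]
  [IsManifold (𝓡 n) ∞ P]

theorem IsPullback.comp {φ : N → P} {ψ : M → N} {g : RiemMetric n P} {g' : RiemMetric n N}
    {g'' : RiemMetric n M} (h : IsPullback φ g g') (h' : IsPullback ψ g' g'') :
    IsPullback (φ ∘ ψ) g g'' := by
  refine ⟨h.1.comp h'.1, fun x u v => ?_⟩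
  have hc := mfderiv_comp x ((h.1 _).mdifferentiableAt (by simp))
    ((h'.1 x).mdifferentiableAt (by simp))
  rw [h'.2, h.2, hc]
  rfl

theorem isPullback_id (g : RiemMetric n M) : IsPullback id g g :=
  ⟨contMDiff_id, fun x u v => by rw [mfderiv_id]; rfl⟩

end PullbackComp

/-! ### The antipodal map is an isometry -/

section AntipodalIsometry

variable {n : ℕ}

theorem contMDiff_neg_sph : ContMDiff (𝓡 n) (𝓡 n) ∞ (fun x : Sph n => -x) :=
  have := fact_finrank_euclideanSpace_succ n
  contMDiff_neg_sphere

/-- The antipodal map as a diffeomorphism. -/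
def negDiffeomorph (n : ℕ) : Sph n ≃ₘ^∞⟮𝓡 n, 𝓡 n⟯ Sph n where
  toEquiv := Equiv.neg (Sph n)
  contMDiff_toFun := contMDiff_neg_sph
  contMDiff_invFun := contMDiff_neg_sph

theorem mfderiv_coe_sph (x : Sph n) (u : TangentSpace (𝓡 n) x) :
    mfderiv (𝓡 n) (𝓡 (n + 1)) ((↑) : Sph n → EuclideanSpace ℝ (Fin (n + 1))) x u =
      tangentIncl x u := by
  rw [((contMDiff_coe_sph x).mdifferentiableAt (by simp)).mfderiv]
  simp only [writtenInExtChartAt, modelWithCornersSelf_coe, Set.range_id, fderivWithin_univ,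
    extChartAt_sph_self]
  exact DFunLike.congr_fun (hasFDerivAt_chartParam x).fderiv u

/-- The charts at x and -x are unrelated, so the differential is computed in the ambient space,
where the antipodal map is linear. -/
theorem tangentIncl_mfderiv_neg (x : Sph n) (u : TangentSpace (𝓡 n) x) :
    tangentIncl (-x) (mfderiv (𝓡 n) (𝓡 n) (fun x : Sph n => -x) x u) = -tangentIncl x u := by
  have h1 := mfderiv_comp x ((contMDiff_coe_sph (-x)).mdifferentiableAt (by simp))
    ((contMDiff_neg_sph x).mdifferentiableAt (by simp))
  have h2 : ((↑) : Sph n → EuclideanSpace ℝ (Fin (n + 1))) ∘ (fun x : Sph n => -x) =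
      fun x : Sph n => -(x : EuclideanSpace ℝ (Fin (n + 1))) := rfl
  have h4 : mfderiv (𝓡 n) (𝓡 (n + 1)) (fun x : Sph n => -(x : EuclideanSpace ℝ (Fin (n + 1)))) x =
      -mfderiv (𝓡 n) (𝓡 (n + 1)) ((↑) : Sph n → EuclideanSpace ℝ (Fin (n + 1))) x :=
    mfderiv_neg
  rw [h2, h4] at h1
  have h3 := DFunLike.congr_fun h1 u
  have h5 : -mfderiv (𝓡 n) (𝓡 (n + 1)) ((↑) : Sph n → EuclideanSpace ℝ (Fin (n + 1))) x u =
    mfderiv (𝓡 n) (𝓡 (n + 1)) ((↑) : Sph n → EuclideanSpace ℝ (Fin (n + 1))) (-x)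
      (mfderiv (𝓡 n) (𝓡 n) (fun x : Sph n => -x) x u) := h3
  rw [mfderiv_coe_sph] at h5
  exact (h5.trans (mfderiv_coe_sph (-x) _)).symm

theorem RiemMetric.inner_eq_ambientForm (g : RiemMetric n (Sph n)) (x : Sph n)
    (u v : EuclideanSpace ℝ (Fin n)) :
    g.inner x u v = ambientForm g x (tangentIncl x u) (tangentIncl x v) := by
  rw [ambientForm_apply, radialForm_apply]
  have h1 : ∀ w : EuclideanSpace ℝ (Fin n),
      ⟪(x : EuclideanSpace ℝ (Fin (n + 1))), tangentIncl x w⟫ = 0 := fun w => by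
    rw [real_inner_comm, inner_tangentIncl]
  have h2 : ∀ w : EuclideanSpace ℝ (Fin n), mfderiv (𝓡 (n + 1)) (𝓡 n) (radialRetraction n)
      (x : EuclideanSpace ℝ (Fin (n + 1))) (tangentIncl x w) = w := fun w =>
    (congrArg _ (mfderiv_coe_sph x w).symm).trans (mfderiv_radialRetraction_coe x w)
  rw [h1, h1, zero_mul, add_zero]
  refine (g.inner_congr_point (radialRetraction_coe x).symm u v).trans ?_
  exact congrArg₂ (fun a b : EuclideanSpace ℝ (Fin n) => g.inner (radialRetraction n x) a b)
    (h2 u).symm (h2 v).symm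

set_option synthInstance.maxHeartbeats 100000 in
theorem MinEqMetric.isPullback_neg (hn : 2 ≤ n) (g : MinEqMetric n) :
    IsPullback (fun x : Sph n => -x) g.1 g.1 := by
  refine ⟨contMDiff_neg_sph, fun x u v => ?_⟩
  have h1 : ∀ w : EuclideanSpace ℝ (Fin n),
      ⟪(x : EuclideanSpace ℝ (Fin (n + 1))), tangentIncl x w⟫ = 0 := fun w => by
    rw [real_inner_comm, inner_tangentIncl]
  have h2 : ∀ a b : EuclideanSpace ℝ (Fin (n + 1)),
      ambientForm g.1 ↑(-x) (-a) (-b) = ambientForm g.1 ↑(-x) a b := fun a b => by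
    simp only [map_neg, neg_apply, neg_neg]
  refine (RiemMetric.inner_eq_ambientForm g.1 x u v).trans ?_
  refine Eq.trans ?_ (RiemMetric.inner_eq_ambientForm g.1 (-x) _ _).symm
  refine Eq.trans ?_ (congrArg₂ (fun a b => ambientForm g.1 ↑(-x) a b)
    (tangentIncl_mfderiv_neg x u) (tangentIncl_mfderiv_neg x v)).symm
  exact ((h2 _ _).trans (ambientForm_neg hn g.2 x (h1 u) (h1 v))).symm

theorem MinEqMetric.isRiemannianIsometry_neg (hn : 2 ≤ n) (g : MinEqMetric n) :
    IsRiemannianIsometry (fun x : Sph n => -x) g.1 :=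
  ⟨⟨negDiffeomorph n, rfl⟩, g.isPullback_neg hn⟩

end AntipodalIsometry

/-! ### The action of the projective linear group -/

section ProjectiveAction

variable {n : ℕ}

theorem toEuclideanLin_mul_apply (S T : Matrix (Fin (n + 1)) (Fin (n + 1)) ℝ)
    (x : EuclideanSpace ℝ (Fin (n + 1))) :
    Matrix.toEuclideanLin (S * T) x = Matrix.toEuclideanLin S (Matrix.toEuclideanLin T x) := by
  simp [Matrix.toEuclideanLin]

theorem toEuclideanLin_GL_surjective (T : GL (Fin (n + 1)) ℝ) :
    Function.Surjective (Matrix.toEuclideanLin (T : Matrix (Fin (n + 1)) (Fin (n + 1)) ℝ)) := by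
  intro x
  refine ⟨Matrix.toEuclideanLin ((T⁻¹ : GL (Fin (n + 1)) ℝ) : Matrix (Fin (n + 1)) (Fin (n + 1)) ℝ) x, ?_⟩
  rw [← toEuclideanLin_mul_apply, ← Units.val_mul, mul_inv_cancel]
  simp [Matrix.toEuclideanLin]

theorem toEuclideanLin_GL_injective (T : GL (Fin (n + 1)) ℝ) :
    Function.Injective (Matrix.toEuclideanLin (T : Matrix (Fin (n + 1)) (Fin (n + 1)) ℝ)) := by
  refine Function.LeftInverse.injective
    (g := Matrix.toEuclideanLin ((T⁻¹ : GL (Fin (n + 1)) ℝ) : Matrix (Fin (n + 1)) (Fin (n + 1)) ℝ)) fun x => ?_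
  rw [← toEuclideanLin_mul_apply, ← Units.val_mul, inv_mul_cancel]
  simp [Matrix.toEuclideanLin]

theorem toEuclideanLin_GL_ne_zero (T : GL (Fin (n + 1)) ℝ) (x : Sph n) :
    Matrix.toEuclideanLin (T : Matrix (Fin (n + 1)) (Fin (n + 1)) ℝ) x ≠ 0 := fun h =>
  sph_coe_ne_zero x (toEuclideanLin_GL_injective T (h.trans (map_zero _).symm))

theorem coe_sphMap (T : GL (Fin (n + 1)) ℝ) (x : Sph n) :
    (sphMap T x : EuclideanSpace ℝ (Fin (n + 1))) =
      ‖Matrix.toEuclideanLin (T : Matrix (Fin (n + 1)) (Fin (n + 1)) ℝ) x‖⁻¹ •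
        Matrix.toEuclideanLin (T : Matrix (Fin (n + 1)) (Fin (n + 1)) ℝ) x := rfl

/-- Positively proportional points of the sphere are equal. -/
theorem sph_eq_of_eq_smul {x y : Sph n} {r : ℝ} (hr : 0 < r)
    (h : (x : EuclideanSpace ℝ (Fin (n + 1))) = r • (y : EuclideanSpace ℝ (Fin (n + 1)))) :
    x = y := by
  have h1 := congrArg norm h
  rw [norm_smul, norm_eq_of_mem_sphere, norm_eq_of_mem_sphere, mul_one,
    Real.norm_of_nonneg hr.le] at h1
  rw [← h1, one_smul] at h
  exact Subtype.ext h

/-- Both sides are unit vectors and positive multiples of S T x. -/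
theorem sphMap_mul (S T : GL (Fin (n + 1)) ℝ) : sphMap (S * T) = sphMap S ∘ sphMap T := by
  funext x
  have h1 := toEuclideanLin_GL_ne_zero (S * T) x
  have h2 := toEuclideanLin_GL_ne_zero S (sphMap T x)
  have h3 := toEuclideanLin_GL_ne_zero T x
  rw [Function.comp_apply]
  refine sph_eq_of_eq_smul (mul_pos (mul_pos (inv_pos.2 (norm_pos_iff.2 h1)) (norm_pos_iff.2 h2))
    (norm_pos_iff.2 h3)) ?_
  rw [coe_sphMap (S * T), coe_sphMap S, coe_sphMap T, map_smul, Units.val_mul,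
    toEuclideanLin_mul_apply, smul_smul, smul_smul]
  rw [coe_sphMap T, map_smul] at h2
  congr 1
  have h2' := norm_ne_zero_iff.2 h2
  have h3' := norm_ne_zero_iff.2 h3
  generalize ‖‖Matrix.toEuclideanLin (T : Matrix (Fin (n + 1)) (Fin (n + 1)) ℝ) x‖⁻¹ •
    Matrix.toEuclideanLin (S : Matrix (Fin (n + 1)) (Fin (n + 1)) ℝ)
      (Matrix.toEuclideanLin (T : Matrix (Fin (n + 1)) (Fin (n + 1)) ℝ) x)‖ = a at h2' ⊢
  field_simp

theorem sphMap_one : sphMap (1 : GL (Fin (n + 1)) ℝ) = id := by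
  funext x
  apply Subtype.ext
  rw [coe_sphMap]
  simp [Matrix.toEuclideanLin]

theorem contMDiff_sphMap (T : GL (Fin (n + 1)) ℝ) : ContMDiff (𝓡 n) (𝓡 n) ∞ (sphMap T) := by
  have := fact_finrank_euclideanSpace_succ n
  have h1 : ContMDiff (𝓡 n) (𝓡 (n + 1)) ∞ (fun x : Sph n =>
      (sphMap T x : EuclideanSpace ℝ (Fin (n + 1)))) := by
    intro x
    have h2 : ContDiffAt ℝ ∞ (fun y => ‖Matrix.toEuclideanLin (T : Matrix (Fin (n + 1)) (Fin (n + 1)) ℝ) y‖⁻¹ •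
        Matrix.toEuclideanLin (T : Matrix (Fin (n + 1)) (Fin (n + 1)) ℝ) y) (x : EuclideanSpace ℝ (Fin (n + 1))) := by
      have h3 : ContDiffAt ℝ ∞ (fun y => Matrix.toEuclideanLin (T : Matrix (Fin (n + 1)) (Fin (n + 1)) ℝ) y)
          (x : EuclideanSpace ℝ (Fin (n + 1))) :=
        (LinearMap.toContinuousLinearMap (Matrix.toEuclideanLin
          (T : Matrix (Fin (n + 1)) (Fin (n + 1)) ℝ))).contDiff.contDiffAt
      exact ((h3.norm ℝ (toEuclideanLin_GL_ne_zero T x)).inv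
        (norm_ne_zero_iff.2 (toEuclideanLin_GL_ne_zero T x))).smul h3
    exact h2.contMDiffAt.comp x (contMDiff_coe_sph x)
  exact ContMDiff.codRestrict_sphere h1 fun x => (sphMap T x).2

/-- The map `φ(T)` as a diffeomorphism. -/
def sphMapDiffeomorph (T : GL (Fin (n + 1)) ℝ) : Sph n ≃ₘ^∞⟮𝓡 n, 𝓡 n⟯ Sph n where
  toFun := sphMap T
  invFun := sphMap T⁻¹
  left_inv x := by
    rw [← Function.comp_apply (f := sphMap T⁻¹), ← sphMap_mul, inv_mul_cancel, sphMap_one]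
    rfl
  right_inv x := by
    rw [← Function.comp_apply (f := sphMap T), ← sphMap_mul, mul_inv_cancel, sphMap_one]
    rfl
  contMDiff_toFun := contMDiff_sphMap T
  contMDiff_invFun := contMDiff_sphMap T⁻¹

theorem isLocalDiffeomorph_sphMap (T : GL (Fin (n + 1)) ℝ) :
    IsLocalDiffeomorph (𝓡 n) (𝓡 n) ∞ (sphMap T) :=
  (sphMapDiffeomorph T).isLocalDiffeomorph

/-- ⟨T x, w⟩ = ⟨x, T* w⟩, so `w` is the preimage of `v` under the invertible adjoint. -/
theorem exists_equator_eq_preimage (T : GL (Fin (n + 1)) ℝ) {v : EuclideanSpace ℝ (Fin (n + 1))}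
    (hv : v ≠ 0) : ∃ w : EuclideanSpace ℝ (Fin (n + 1)), w ≠ 0 ∧
      sphMap T ⁻¹' equator w = equator v := by
  have hadj : ∀ w : EuclideanSpace ℝ (Fin (n + 1)), sphMap T ⁻¹' equator w =
      equator (LinearMap.adjoint (Matrix.toEuclideanLin (T : Matrix (Fin (n + 1)) (Fin (n + 1)) ℝ)) w) := by
    intro w
    ext x
    change ⟪(sphMap T x : EuclideanSpace ℝ (Fin (n + 1))), w⟫ = 0 ↔
      ⟪(x : EuclideanSpace ℝ (Fin (n + 1))),
        LinearMap.adjoint (Matrix.toEuclideanLin (T : Matrix (Fin (n + 1)) (Fin (n + 1)) ℝ)) w⟫ = 0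
    rw [coe_sphMap, real_inner_smul_left, LinearMap.adjoint_inner_right, mul_eq_zero, or_iff_right]
    exact inv_ne_zero (norm_ne_zero_iff.2 (toEuclideanLin_GL_ne_zero T x))
  have hinj : Function.Injective
      (LinearMap.adjoint (Matrix.toEuclideanLin (T : Matrix (Fin (n + 1)) (Fin (n + 1)) ℝ))) := by
    rw [← LinearMap.ker_eq_bot, LinearMap.ker_eq_bot']
    intro w hw
    obtain ⟨y, hy⟩ := toEuclideanLin_GL_surjective T w
    have := LinearMap.adjoint_inner_right (Matrix.toEuclideanLin (T : Matrix (Fin (n + 1)) (Fin (n + 1)) ℝ)) y w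
    rw [hw, inner_zero_right, hy] at this
    exact inner_self_eq_zero.1 this.symm
  obtain ⟨w, hw⟩ := LinearMap.injective_iff_surjective.1 hinj v
  refine ⟨w, ?_, by rw [hadj, hw]⟩
  rintro rfl
  rw [map_zero] at hw
  exact hv hw.symm

/-- The pull-back of a metric with minimal equators by `φ(T)`. -/
def MinEqMetric.act (T : GL (Fin (n + 1)) ℝ) (g : MinEqMetric n) : MinEqMetric n :=
  ⟨g.1.pullback (sphMap T) (isLocalDiffeomorph_sphMap T), fun v hv => by
    obtain ⟨w, hw, hwv⟩ := exists_equator_eq_preimage T hv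
    rw [← hwv]
    exact (g.2 w hw).preimage (g.1.isPullback_pullback _ _) (isLocalDiffeomorph_sphMap T)⟩

theorem MinEqMetric.isPullback_act (T : GL (Fin (n + 1)) ℝ) (g : MinEqMetric n) :
    IsPullback (sphMap T) g.1 (g.act T).1 := g.1.isPullback_pullback _ (isLocalDiffeomorph_sphMap T)

theorem MinEqMetric.act_one (g : MinEqMetric n) : g.act 1 = g := by
  have h := g.isPullback_act 1
  rw [sphMap_one] at h
  exact Subtype.ext (h.unique (isPullback_id g.1))

theorem MinEqMetric.act_mul (S T : GL (Fin (n + 1)) ℝ) (g : MinEqMetric n) :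
    g.act (S * T) = (g.act S).act T := by
  have h := (g.isPullback_act S).comp ((g.act S).isPullback_act T)
  rw [← sphMap_mul] at h
  exact Subtype.ext ((g.isPullback_act (S * T)).unique h)

/-- Only the sign of the scalar survives normalisation; a negative one is the case in which
antipodal invariance is needed. -/
theorem sphMap_mul_scalar (T : GL (Fin (n + 1)) ℝ) (u : ℝˣ) :
    sphMap (T * .scalar _ u) = sphMap T ∨ sphMap (T * .scalar _ u) = fun x => -sphMap T x := by
  have hlin : ∀ x : Sph n, Matrix.toEuclideanLin ((T * .scalar _ u : GL (Fin (n + 1)) ℝ) :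
      Matrix (Fin (n + 1)) (Fin (n + 1)) ℝ) x =
      (u : ℝ) • Matrix.toEuclideanLin (T : Matrix (Fin (n + 1)) (Fin (n + 1)) ℝ) x := by
    intro x
    rw [Units.val_mul, toEuclideanLin_mul_apply, ← map_smul]
    congr 1
    ext i
    simp [Matrix.toEuclideanLin, Matrix.mulVec_diagonal]
  rcases lt_or_gt_of_ne u.ne_zero with hu | hu
  · right
    funext x
    apply Subtype.ext
    rw [coe_neg_sphere, coe_sphMap, coe_sphMap, hlin, norm_smul, Real.norm_of_nonpos hu.le,
      smul_smul, ← neg_smul]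
    congr 1
    field_simp
  · left
    funext x
    apply Subtype.ext
    rw [coe_sphMap, coe_sphMap, hlin, norm_smul, Real.norm_of_nonneg hu.le, smul_smul]
    congr 1
    field_simp

theorem MinEqMetric.act_eq_of_mk_eq (hn : 2 ≤ n) {T T' : GL (Fin (n + 1)) ℝ}
    (h : Matrix.ProjGenLinGroup.mk T = Matrix.ProjGenLinGroup.mk T') (g : MinEqMetric n) :
    g.act T = g.act T' := by
  obtain ⟨u, rfl⟩ := Matrix.ProjGenLinGroup.mk_eq_mk_iff.1 h
  have h' := g.isPullback_act (T * .scalar _ u)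
  rcases sphMap_mul_scalar T u with hu | hu
  · rw [hu] at h'
    exact Subtype.ext ((g.isPullback_act T).unique h')
  · rw [hu] at h'
    exact Subtype.ext (((g.isPullback_neg hn).comp (g.isPullback_act T)).unique h')

/-- The right action of `PGL(n+1, ℝ)` on the metrics with minimal equators. -/
@[reducible]
def MinEqMetric.mulAction (hn : 2 ≤ n) :
    MulAction (Matrix.ProjGenLinGroup (Fin (n + 1)) ℝ)ᵐᵒᵖ (MinEqMetric n) where
  smul c g := g.act (Function.surjInv Matrix.ProjGenLinGroup.mk_surjective c.unop)
  one_smul g := by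
    refine Eq.trans ?_ g.act_one
    refine act_eq_of_mk_eq hn ?_ g
    rw [Function.surjInv_eq Matrix.ProjGenLinGroup.mk_surjective, unop_one, map_one]
  -- `unop` reverses the product `c * d`, which matches the order of pull-backs in `act_mul`.
  mul_smul c d g := by
    refine Eq.trans ?_ (act_mul _ _ g)
    refine act_eq_of_mk_eq hn ?_ g
    simp only [map_mul, Function.surjInv_eq Matrix.ProjGenLinGroup.mk_surjective, unop_mul]

/-- Uniqueness: every class has a representative in GL, and a pull-back metric is determined by the
map and the original metric. -/
theorem MinEqMetric.existsUnique_mulAction (hn : 2 ≤ n) :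
    ∃! a : MulAction (Matrix.ProjGenLinGroup (Fin (n + 1)) ℝ)ᵐᵒᵖ (MinEqMetric n),
      ∀ (T : GL (Fin (n + 1)) ℝ) (g : MinEqMetric n),
        IsPullback (sphMap T) g.1 (a.smul (op (Matrix.ProjGenLinGroup.mk T)) g).1 := by
  refine ⟨mulAction hn, fun T g => ?_, fun a ha => ?_⟩
  · have h : (mulAction hn).smul (op (Matrix.ProjGenLinGroup.mk T)) g = g.act T :=
      act_eq_of_mk_eq hn (Function.surjInv_eq _ _) g
    rw [h]
    exact g.isPullback_act T
  · refine MulAction.ext (funext fun c => funext fun g => ?_)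
    obtain ⟨T, hT⟩ := Matrix.ProjGenLinGroup.mk_surjective c.unop
    have h1 := ha T g
    rw [hT] at h1
    exact Subtype.ext (h1.unique (by
      have h : (mulAction hn).smul c g = g.act T :=
        act_eq_of_mk_eq hn ((Function.surjInv_eq _ _).trans hT.symm) g
      change IsPullback (sphMap T) g.1 ((mulAction hn).smul c g).1
      rw [h]
      exact g.isPullback_act T))

end ProjectiveAction

end

noncomputable section

open Filter Topology Bundle Metric

/-! ### The projection to projective space as a local diffeomorphism -/

section Projection

variable {n : ℕ}

theorem isLocalHomeomorph_projSph (n : ℕ) : IsLocalHomeomorph (projSph n) :=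
  isQuotientCoveringMap_quotientMk_of_properlyDiscontinuousSMul.isCoveringMap
    |>.isLocalHomeomorph

theorem projSph_surjective (n : ℕ) : Function.Surjective (projSph n) := Quotient.mk_surjective

/-- The charts of the quotient are built from chosen points of the sphere; the existential hides
that choice. -/
theorem exists_chartAt_rProj_eq (q : RProj n) : ∃ z : Sph n,
    chartAt (EuclideanSpace ℝ (Fin n)) q =
      ((isLocalHomeomorph_projSph n).localInverseAt z).trans
        (chartAt (EuclideanSpace ℝ (Fin n)) z) :=
  ⟨_, rfl⟩

theorem contMDiff_projSph : ContMDiff (𝓡 n) (𝓡 n) ∞ (projSph n) := by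
  intro x
  have hf := isLocalHomeomorph_projSph n
  refine contMDiffAt_iff_target.2 ⟨hf.continuous.continuousAt, ?_⟩
  obtain ⟨z, hz⟩ := exists_chartAt_rProj_eq (projSph n x)
  have hx := mem_chart_source (EuclideanSpace ℝ (Fin n)) (projSph n x)
  rw [hz, OpenPartialHomeomorph.trans_source] at hx
  have h1 := (localInverse_projSph_contMDiffAt hf z x hx.1).of_le (m := ∞) (by simp)
  have h2 : ContMDiffAt (𝓡 n) (𝓡 n) ∞ (chartAt (EuclideanSpace ℝ (Fin n)) z)
      (hf.localInverseAt z (projSph n x)) :=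
    contMDiffOn_chart.contMDiffAt ((chartAt _ z).open_source.mem_nhds hx.2)
  have h3 : extChartAt (𝓡 n) (projSph n x) ∘ projSph n =
      chartAt (EuclideanSpace ℝ (Fin n)) z ∘ fun w => hf.localInverseAt z (projSph n w) := by
    rw [extChartAt_coe, hz]
    rfl
  rw [h3]
  exact ContMDiffAt.comp (g := chartAt (EuclideanSpace ℝ (Fin n)) z)
      (f := fun w => hf.localInverseAt z (projSph n w)) _ h2 h1

theorem contMDiffOn_localInverseAt_projSph (z : Sph n) :
    ContMDiffOn (𝓡 n) (𝓡 n) ∞ ((isLocalHomeomorph_projSph n).localInverseAt z)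
      ((isLocalHomeomorph_projSph n).localInverseAt z).source := by
  intro q hq
  have hf := isLocalHomeomorph_projSph n
  refine ContMDiffAt.contMDiffWithinAt ?_
  rw [contMDiffAt_iff_source, modelWithCornersSelf_coe, Set.range_id, contMDiffWithinAt_univ]
  obtain ⟨z', hz'⟩ := exists_chartAt_rProj_eq q
  have h0 := extChartAt_to_inv (I := 𝓡 n) q
  have h3 : ((extChartAt (𝓡 n) q).symm : EuclideanSpace ℝ (Fin n) → RProj n) =
      projSph n ∘ (chartAt (EuclideanSpace ℝ (Fin n)) z').symm := by
    rw [extChartAt_coe_symm, hz']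
    exact congrArg (· ∘ (chartAt (EuclideanSpace ℝ (Fin n)) z').symm) (hf.localInverseAt_symm z')
  have hy := mem_extChartAt_target (I := 𝓡 n) q
  have hy' : extChartAt (𝓡 n) q q ∈ (chartAt (EuclideanSpace ℝ (Fin n)) z').target := by
    rw [extChartAt_target, hz'] at hy
    simp only [mfld_simps] at hy
    exact hy.1
  rw [h3] at h0 ⊢
  have h1 : ContMDiffAt (𝓡 n) (𝓡 n) ∞ (chartAt (EuclideanSpace ℝ (Fin n)) z').symm
      (extChartAt (𝓡 n) q q) :=
    contMDiffOn_chart_symm.contMDiffAt ((chartAt _ z').open_target.mem_nhds hy')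
  have h2 := (localInverse_projSph_contMDiffAt hf z
    ((chartAt (EuclideanSpace ℝ (Fin n)) z').symm (extChartAt (𝓡 n) q q))
    (by rw [← Function.comp_apply (f := projSph n), h0]; exact hq)).of_le (m := ∞) (by simp)
  exact h2.comp _ h1

/-- The local inverses of the projection as local diffeomorphisms. -/
def projSphLocalInverse (z : Sph n) : PartialDiffeomorph (𝓡 n) (𝓡 n) (RProj n) (Sph n) ∞ where
  toPartialEquiv := ((isLocalHomeomorph_projSph n).localInverseAt z).toPartialEquiv
  open_source := ((isLocalHomeomorph_projSph n).localInverseAt z).open_source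
  open_target := ((isLocalHomeomorph_projSph n).localInverseAt z).open_target
  contMDiffOn_toFun := contMDiffOn_localInverseAt_projSph z
  contMDiffOn_invFun := by
    have h := (isLocalHomeomorph_projSph n).localInverseAt_symm z
    have h' : ((isLocalHomeomorph_projSph n).localInverseAt z).toPartialEquiv.invFun =
      projSph n := h
    rw [h']
    exact contMDiff_projSph.contMDiffOn

theorem isLocalDiffeomorph_projSph (n : ℕ) :
    IsLocalDiffeomorph (𝓡 n) (𝓡 n) ∞ (projSph n) := fun x =>
  ⟨(projSphLocalInverse x).symm,
    (isLocalHomeomorph_projSph n).self_mem_localInverseAt_target,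
    fun _ _ => (congrFun ((isLocalHomeomorph_projSph n).localInverseAt_symm x) _).symm⟩

/-- Equators are symmetric under the antipodal map. -/
theorem projSph_preimage_image_equator (v : EuclideanSpace ℝ (Fin (n + 1))) :
    projSph n ⁻¹' (projSph n '' equator v) = equator v := by
  refine Subset.antisymm ?_ (subset_preimage_image _ _)
  rintro x ⟨y, hy, hxy⟩
  rcases projSph_eq_iff.1 hxy with rfl | rfl
  · exact hy
  · have h : ⟪((-x : Sph n) : EuclideanSpace ℝ (Fin (n + 1))), v⟫ = 0 := hy
    change ⟪(x : EuclideanSpace ℝ (Fin (n + 1))), v⟫ = 0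
    rwa [coe_neg_sphere, inner_neg_left, neg_eq_zero] at h

end Projection

/-! ### Descent of metrics to projective space -/

section Descent

variable {n : ℕ}

/-- The differential of the projection. -/
def projSphDeriv (x : Sph n) : EuclideanSpace ℝ (Fin n) ≃L[ℝ] EuclideanSpace ℝ (Fin n) :=
  (isLocalDiffeomorph_projSph n).mfderivToContinuousLinearEquiv (by simp) x

/-- The projection is surjective and its differentials are isomorphisms, so the pull-back determines
every inner product below. -/
theorem IsPullback.projSph_unique {g : RiemMetric n (Sph n)} {h₁ h₂ : RiemMetric n (RProj n)}
    (H₁ : IsPullback (projSph n) h₁ g) (H₂ : IsPullback (projSph n) h₂ g) : h₁ = h₂ := by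
  refine RiemMetric.ext' fun q u v => ?_
  obtain ⟨x, rfl⟩ := projSph_surjective n q
  obtain ⟨u, rfl⟩ := (projSphDeriv x).surjective u
  obtain ⟨v, rfl⟩ := (projSphDeriv x).surjective v
  exact (H₁.2 x u v).symm.trans (H₂.2 x u v)

/-- The push-forward to the projective space of the inner product at a point of the sphere. -/
def projSphForm (g : RiemMetric n (Sph n)) (x : Sph n) :
    EuclideanSpace ℝ (Fin n) →L[ℝ] EuclideanSpace ℝ (Fin n) →L[ℝ] ℝ :=
  let B : EuclideanSpace ℝ (Fin n) →L[ℝ] EuclideanSpace ℝ (Fin n) →L[ℝ] ℝ := g.inner x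
  B.bilinearComp ((projSphDeriv x).symm : EuclideanSpace ℝ (Fin n) →L[ℝ] EuclideanSpace ℝ (Fin n))
    ((projSphDeriv x).symm : EuclideanSpace ℝ (Fin n) →L[ℝ] EuclideanSpace ℝ (Fin n))

theorem projSphForm_apply (g : RiemMetric n (Sph n)) (x : Sph n)
    (u v : EuclideanSpace ℝ (Fin n)) :
    projSphForm g x u v = g.inner x ((projSphDeriv x).symm u) ((projSphDeriv x).symm v) := rfl

theorem projSphForm_projSphDeriv (g : RiemMetric n (Sph n)) (x : Sph n)
    (u v : EuclideanSpace ℝ (Fin n)) :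
    projSphForm g x (projSphDeriv x u) (projSphDeriv x v) = g.inner x u v := by
  refine (projSphForm_apply g x _ _).trans ?_
  exact congrArg₂ (fun a b : EuclideanSpace ℝ (Fin n) => g.inner x a b)
    ((projSphDeriv x).symm_apply_apply u) ((projSphDeriv x).symm_apply_apply v)

theorem projSphDeriv_neg (x : Sph n) (u : EuclideanSpace ℝ (Fin n)) :
    projSphDeriv (-x) (mfderiv (𝓡 n) (𝓡 n) (fun x : Sph n => -x) x u) = projSphDeriv x u := by
  have h := mfderiv_comp x ((contMDiff_projSph (-x)).mdifferentiableAt (by simp))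
    ((contMDiff_neg_sph x).mdifferentiableAt (by simp))
  have h1 : projSph n ∘ (fun x : Sph n => -x) = projSph n := funext projSph_neg
  rw [h1] at h
  exact (DFunLike.congr_fun h u).symm

/-- Antipodal invariance makes the pushed-forward inner product independent of the chosen preimage.
-/
theorem projSphForm_neg {g : RiemMetric n (Sph n)} (hg : IsPullback (fun x : Sph n => -x) g g)
    (x : Sph n) : projSphForm g (-x) = projSphForm g x := by
  ext u v
  obtain ⟨u, rfl⟩ := (projSphDeriv x).surjective u
  obtain ⟨v, rfl⟩ := (projSphDeriv x).surjective v
  rw [projSphForm_projSphDeriv, ← projSphDeriv_neg x u, ← projSphDeriv_neg x v]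
  exact (projSphForm_projSphDeriv g (-x) _ _).trans (hg.2 x u v).symm

theorem projSphForm_eq_of_projSph_eq {g : RiemMetric n (Sph n)}
    (hg : IsPullback (fun x : Sph n => -x) g g) {x y : Sph n} (h : projSph n x = projSph n y) :
    projSphForm g x = projSphForm g y := by
  rcases projSph_eq_iff.1 h with rfl | rfl
  · rfl
  · exact projSphForm_neg hg y

theorem projSphDeriv_localInverse (z : Sph n) {q : RProj n}
    (hq : q ∈ (projSphLocalInverse z).source) (u : EuclideanSpace ℝ (Fin n)) :
    projSphDeriv (projSphLocalInverse z q)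
      (mfderiv (𝓡 n) (𝓡 n) (projSphLocalInverse z) q u) = u := by
  have hs : MDifferentiableAt (𝓡 n) (𝓡 n) (projSphLocalInverse z) q :=
    ((projSphLocalInverse z).contMDiffOn.contMDiffAt
      ((projSphLocalInverse z).open_source.mem_nhds hq)).mdifferentiableAt (by simp)
  have h := mfderiv_comp q ((contMDiff_projSph (projSphLocalInverse z q)).mdifferentiableAt
    (by simp)) hs
  have h1 : projSph n ∘ projSphLocalInverse z =ᶠ[𝓝 q] id := by
    filter_upwards [(projSphLocalInverse z).open_source.mem_nhds hq] with y hy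
    exact (isLocalHomeomorph_projSph n).apply_localInverseAt_of_mem hy
  rw [h1.mfderiv_eq, mfderiv_id] at h
  exact (DFunLike.congr_fun h u).symm

/-- The metric on the projective space induced by an antipodally invariant metric on the sphere. -/
def RiemMetric.descend (g : RiemMetric n (Sph n)) (hg : IsPullback (fun x : Sph n => -x) g g) :
    RiemMetric n (RProj n) :=
  RiemMetric.ofIsometric g
    (fun q => projSphForm g (Function.surjInv (projSph_surjective n) q))
    (Function.surjInv (projSph_surjective n))
    (fun q => (projSphDeriv (Function.surjInv (projSph_surjective n) q)).symm)
    (fun _ _ _ => rfl)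
    -- The section `surjInv` need not be continuous. Near each point it is replaced by a smooth
    -- local inverse of the projection, with the same pushed-forward form.
    (fun q => by
      obtain ⟨z, rfl⟩ := projSph_surjective n q
      have hz : projSph n z ∈ (projSphLocalInverse z).source :=
        (isLocalHomeomorph_projSph n).apply_self_mem_localInverseAt_source
      refine contMDiffAt_section_pullback ((projSphLocalInverse z).contMDiffOn.contMDiffAt
        ((projSphLocalInverse z).open_source.mem_nhds hz)) ?_ (g.contMDiff _)
      filter_upwards [(projSphLocalInverse z).open_source.mem_nhds hz] with q hq u v
      have h1 : projSphForm g (Function.surjInv (projSph_surjective n) q) =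
          projSphForm g (projSphLocalInverse z q) :=
        projSphForm_eq_of_projSph_eq hg ((Function.surjInv_eq _ q).trans
          ((isLocalHomeomorph_projSph n).apply_localInverseAt_of_mem hq).symm)
      rw [h1]
      refine Eq.trans ?_ (projSphForm_projSphDeriv g (projSphLocalInverse z q) _ _)
      exact congrArg₂ (fun a b : EuclideanSpace ℝ (Fin n) =>
        projSphForm g (projSphLocalInverse z q) a b)
        (projSphDeriv_localInverse z hq u).symm (projSphDeriv_localInverse z hq v).symm)

theorem RiemMetric.isPullback_descend (g : RiemMetric n (Sph n))
    (hg : IsPullback (fun x : Sph n => -x) g g) : IsPullback (projSph n) (g.descend hg) g := by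
  refine ⟨contMDiff_projSph, fun x u v => ?_⟩
  have h1 : projSphForm g (Function.surjInv (projSph_surjective n) (projSph n x)) =
      projSphForm g x :=
    projSphForm_eq_of_projSph_eq hg (Function.surjInv_eq _ _)
  refine (projSphForm_projSphDeriv g x u v).symm.trans ?_
  rw [← h1]
  rfl

/-- The pull-back to the sphere of a metric with minimal projective hyperplanes. -/
def MinPlaneMetric.pullback (h : MinPlaneMetric n) : MinEqMetric n :=
  ⟨h.1.pullback (projSph n) (isLocalDiffeomorph_projSph n), fun v hv => by
    rw [← projSph_preimage_image_equator v]
    exact (h.2 v hv).preimage (h.1.isPullback_pullback _ (isLocalDiffeomorph_projSph n))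
      (isLocalDiffeomorph_projSph n)⟩

theorem MinPlaneMetric.isPullback_pullback (h : MinPlaneMetric n) :
    IsPullback (projSph n) h.1 h.pullback.1 :=
  h.1.isPullback_pullback _ (isLocalDiffeomorph_projSph n)

theorem MinPlaneMetric.pullback_bijective (hn : 2 ≤ n) :
    Function.Bijective (MinPlaneMetric.pullback (n := n)) := by
  refine ⟨fun h₁ h₂ h => ?_, fun g => ?_⟩
  · have H := h₁.isPullback_pullback
    rw [h] at H
    exact Subtype.ext (H.projSph_unique h₂.isPullback_pullback)
  · have H := g.1.isPullback_descend (g.isPullback_neg hn)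
    refine ⟨⟨g.1.descend (g.isPullback_neg hn), fun v hv => ?_⟩, ?_⟩
    · refine IsMinimalHypersurface.of_preimage H (isLocalDiffeomorph_projSph n)
        (projSph_surjective n) ?_
      rw [projSph_preimage_image_equator]
      exact g.2 v hv
    · exact Subtype.ext ((isPullback_pullback _).unique H)

end Descent

end

theorem mainTheorem6 (n : ℕ) (hn : 2 ≤ n) :
    -- the antipodal map is an isometry
    (∀ g : MinEqMetric n, IsRiemannianIsometry (fun x : Sph n => -x) g.1) ∧
    -- `g · [T] = φ(T)^* g` is a well-defined right action of `PGL(n+1, ℝ)`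
    (∃! a : MulAction (Matrix.ProjGenLinGroup (Fin (n + 1)) ℝ)ᵐᵒᵖ (MinEqMetric n),
      ∀ (T : GL (Fin (n + 1)) ℝ) (g : MinEqMetric n),
        IsPullback (sphMap T) g.1 (a.smul (op (Matrix.ProjGenLinGroup.mk T)) g).1) ∧
    -- each such metric descends to a unique metric on `ℝPⁿ`
    (∀ g : MinEqMetric n, ∃! h : RiemMetric n (RProj n), IsPullback (projSph n) h g.1) ∧
    -- pull-back by the projection is a bijection between the two sets of metrics
    (∃ Φ : MinPlaneMetric n ≃ MinEqMetric n,
      ∀ h : MinPlaneMetric n, IsPullback (projSph n) h.1 (Φ h).1) :=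
  ⟨fun g => g.isRiemannianIsometry_neg hn, MinEqMetric.existsUnique_mulAction hn,
    fun g => ⟨g.1.descend (g.isPullback_neg hn), g.1.isPullback_descend _,
      fun _ H => H.projSph_unique (g.1.isPullback_descend _)⟩,
    Equiv.ofBijective _ (MinPlaneMetric.pullback_bijective hn),
    fun h => h.isPullback_pullback⟩
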